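/- For every constant $C>0$ there are a constant $c>0$ and an integer $\sigma_0$ such that for all integers $\sigma\ge\sigma_0$ and $s\ge C\sigma^2$ there exists a string $S$ of integers in $[0,\sigma)$ such that (i) $S$ is described by a straight line program of size exactly $s$, and (ii) the Cartesian tree $\mathcal C$ of $S$ has a top-tree, and every top-tree compression $\mathcal T$ of $\mathcal C$ has size $|\mathcal T|\ge c\,s\,\sigma$. Here a straight line program (SLP) is an acyclic context-free grammar with exactly one rule for each nonterminal, of the form $X\to YZ$ with nonterminals $Y,Z$ or $X\to a$ with a terminal $a$; its size is the number of its rules. The Cartesian tree of the empty string is empty; that of a nonempty string $S$ is the unlabelled ordered binary tree whose root corresponds to the first occurrence $i$ of the smallest element of $S$, and whose left and right subtrees are the Cartesian trees of $S[1..i-1]$ and $S[i+1..n]$. A cluster of a binary tree $T$ is a connected subgraph with at least one edge in which at most one node other than its topmost node is incident with edges of $T$ outside the subgraph, and such a node is a leaf of the subgraph; the topmost node is called the top boundary node, the other one (if it exists) the bottom boundary node. A top-tree of $T$ is an ordered binary tree, each of whose nodes corresponds to a cluster of $T$, as follows. The root corresponds to $T$ itself. The leaves correspond to the single edges $(v,\mathrm{parent}(v))$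 of $T$, labelled $e_\ell$ or $e_r$ according to whether $v$ is a left or a right child. Each internal node corresponds to the union of the two edge-disjoint clusters of its children, and is labelled $h$ (horizontal merge: the two clusters share their top boundary node) or $v$ (vertical merge: the top boundary node of the left child's cluster is the bottom boundary node of the right child's cluster). A top-tree compression of $T$ is the DAG obtained from a top-tree of $T$ by representing all nodes that have the same labelled rooted subtree by a single node; its size is the number of nodes of the DAG. -/

import Mathlib

/-! ### Straight line programs -/

/-- A straight line program over the alphabet `α`: a context-free grammar in which every
nonterminal `X` has exactly one rule, either `X → a` with a terminal `a` (`Sum.inl a`) or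
`X → Y Z` with nonterminals `Y`, `Z` (`Sum.inr (Y, Z)`), and no nonterminal is reachable from
itself by applying rules. -/
structure SLP (α : Type) where
  /-- the nonterminals -/
  N : Type
  /-- there are finitely many nonterminals -/
  finN : Fintype N
  /-- the right-hand side of the rule of a nonterminal -/
  rule : N → α ⊕ N × N
  /-- the start symbol -/
  start : N
  /-- acyclicity -/
  acyclic : WellFounded fun Y X : N => ∃ Z, rule X = Sum.inr (Y, Z) ∨ rule X = Sum.inr (Z, Y)

/-- `G.Derives X w`: the nonterminal `X` derives the string `w`. -/
inductive SLP.Derives {α : Type} (G : SLP α) : G.N → List α → Prop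
  | terminal (X : G.N) (a : α) (hX : G.rule X = Sum.inl a) : SLP.Derives G X [a]
  | concat (X Y Z : G.N) (u w : List α) (hX : G.rule X = Sum.inr (Y, Z))
      (hY : SLP.Derives G Y u) (hZ : SLP.Derives G Z w) : SLP.Derives G X (u ++ w)

/-- The string `S` is the string described by `G`. -/
def SLP.Generates {α : Type} (G : SLP α) (S : List α) : Prop :=
  G.Derives G.start S

/-- The size of a straight line program: its number of rules (one for each nonterminal). -/
def SLP.size {α : Type} (G : SLP α) : ℕ :=
  @Fintype.card G.N G.finN

/-! ### Cartesian trees -/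

/-- The index (counted from `0`) of the first occurrence of the smallest element of the nonempty
string `a :: l`. -/
def firstMinIdx (a : ℕ) (l : List ℕ) : ℕ :=
  (a :: l).idxOf (l.foldl min a)

theorem firstMinIdx_lt (a : ℕ) (l : List ℕ) : firstMinIdx a l < (a :: l).length := by
  have key : ∀ (l : List ℕ) (a : ℕ), l.foldl min a ∈ a :: l := by
    intro l
    induction l with
    | nil => intro a; simp
    | cons b l ih =>
      intro a
      have h := ih (min a b)
      rcases min_choice a b with hab | hab <;> rw [List.foldl_cons] <;> rw [hab] at h ⊢ <;>
        simp only [List.mem_cons] at h ⊢ <;> tauto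
  exact List.idxOf_lt_length_of_mem (key l a)

/-- The Cartesian tree of a string of integers, as an unlabelled binary tree: the root is the
first occurrence of the smallest element, its left and right subtrees are the Cartesian trees of
the parts of the string before and after it. -/
def cartesianTree : List ℕ → BinaryTree Unit
  | [] => BinaryTree.nil
  | a :: l =>
    BinaryTree.node ()
      (cartesianTree ((a :: l).take (firstMinIdx a l)))
      (cartesianTree ((a :: l).drop (firstMinIdx a l + 1)))
termination_by S => S.length
decreasing_by
  · have h := firstMinIdx_lt a l
    rw [List.length_take]
    omega
  · simp only [List.length_drop, List.length_cons]
    omega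

/-! ### Clusters of a binary tree -/

/-- A position in a binary tree: the path from the node *up* to the root, `false` for a step from
a left child and `true` for a step from a right child. So `[]` is the root, `false :: p` and
`true :: p` are the left and the right child of `p`, and `e.tail` is the parent of `e ≠ []`. -/
abbrev TreePos : Type := List Bool

/-- The subtree of `T` rooted at a position (empty if `T` has no node there). -/
def subtreeAt (T : BinaryTree Unit) : TreePos → BinaryTree Unit
  | [] => T
  | false :: p => (subtreeAt T p).left
  | true :: p => (subtreeAt T p).right

/-- The edges of `T`. The edge between a node `e ≠ []` and its parent `e.tail` is represented by
its lower endpoint `e`. -/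
def treeEdges (T : BinaryTree Unit) : Set TreePos :=
  {e | e ≠ [] ∧ subtreeAt T e ≠ BinaryTree.nil}

/-- The edge set `E` is nonempty and connected, and its topmost node (the top boundary node)
is `r`. -/
def IsTopNode (E : Set TreePos) (r : TreePos) : Prop :=
  E.Nonempty ∧ ∀ e ∈ E, e.tail = r ∨ e.tail ∈ E

/-- `b` is a node of the edge set `E`, different from its topmost node, that has a neighbour in
`T` outside `E`, i.e. is incident with an edge of `T` outside `E`. -/
def IsBottomNode (T : BinaryTree Unit) (E : Set TreePos) (b : TreePos) : Prop :=
  b ∈ E ∧ ∃ d : Bool, (d :: b) ∈ treeEdges T ∧ (d :: b) ∉ E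

/-- A cluster of `T`, given by its set of edges: a nonempty connected subgraph in which at most
one node other than the topmost one is incident with edges of `T` outside the subgraph, and such a
node (the bottom boundary node) is a leaf of the subgraph. -/
structure IsCluster (T : BinaryTree Unit) (E : Set TreePos) : Prop where
  subset_edges : E ⊆ treeEdges T
  connected : ∃ r, IsTopNode E r
  bottom_leaf : ∀ b, IsBottomNode T E b → ∀ d : Bool, (d :: b) ∉ E
  bottom_unique : ∀ b b', IsBottomNode T E b → IsBottomNode T E b' → b = b'

/-! ### Top-trees and their DAG compression -/

/-- Ordered binary trees whose leaves are labelled `e_ℓ` (`edge false`) or `e_r` (`edge true`), and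
whose internal nodes are labelled as horizontal or vertical merges. -/
inductive TopTree : Type
  | edge (right : Bool) : TopTree
  | horizontal (A B : TopTree) : TopTree
  | vertical (A B : TopTree) : TopTree
  deriving DecidableEq

/-- `IsClusterTree T t E`: the labelled tree `t` describes a way of building the cluster of `T` with
edge set `E` from single edges. A leaf is a single edge, labelled by whether its lower endpoint is
a left or a right child. An internal node merges two edge-disjoint clusters whose union is again a
cluster: horizontally, if they share their top boundary node, and vertically, if the top boundary
node of the left child is the bottom boundary node of the right child. -/
inductive IsClusterTree (T : BinaryTree Unit) : TopTree → Set TreePos → Prop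
  | edge (d : Bool) (p : TreePos) (hp : (d :: p) ∈ treeEdges T) :
      IsClusterTree T (TopTree.edge d) {d :: p}
  | horizontal (A B : TopTree) (E F : Set TreePos) (r : TreePos)
      (hA : IsClusterTree T A E) (hB : IsClusterTree T B F) (hd : Disjoint E F)
      (hE : IsTopNode E r) (hF : IsTopNode F r) (hc : IsCluster T (E ∪ F)) :
      IsClusterTree T (TopTree.horizontal A B) (E ∪ F)
  | vertical (A B : TopTree) (E F : Set TreePos) (b : TreePos)
      (hA : IsClusterTree T A E) (hB : IsClusterTree T B F) (hd : Disjoint E F)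
      (hE : IsTopNode E b) (hF : IsBottomNode T F b) (hc : IsCluster T (E ∪ F)) :
      IsClusterTree T (TopTree.vertical A B) (E ∪ F)

/-- `t` is a top-tree of `T`: its root corresponds to the whole tree `T`. -/
def IsTopTree (T : BinaryTree Unit) (t : TopTree) : Prop :=
  IsClusterTree T t (treeEdges T)

/-- The set of the distinct rooted (labelled) subtrees of a top-tree. -/
def TopTree.subtrees : TopTree → Finset TopTree
  | TopTree.edge d => {TopTree.edge d}
  | TopTree.horizontal A B => insert (TopTree.horizontal A B) (A.subtrees ∪ B.subtrees)
  | TopTree.vertical A B => insert (TopTree.vertical A B) (A.subtrees ∪ B.subtrees)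

/-- The size of the DAG compression of a top-tree, in which all nodes with the same rooted subtree
are represented by one node of the DAG: the number of nodes of the DAG. -/
def TopTree.dagSize (t : TopTree) : ℕ :=
  t.subtrees.card

/-! ### Positions in a binary tree -/

/-! The hard string is a sequence of m² blocks separated by the letter 0, so its Cartesian tree is a
right path of separators with one zigzag per block. At every zigzag node hangs a right path whose
length is a power of two. The exponent encodes the height r together with `u / m` if r is even and
`u % m` if r is odd. In the string, even heights lie before the center of the block and odd heights
after it, so m prefixes and m suffixes suffice for all m² blocks, and an SLP of size O(mL + m²)
exists (`exists_slp_hardString`). With L about σ and m a small multiple of √s this is at most s.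

In a top-tree, take for each zigzag u and each k < L/2 the least cluster containing the spine edges
2k and 2k+2. A node with n leaves has a cluster of n edges, so clusters of different sizes give
different DAG nodes (`card_le_dagSize`). It remains to show that the m²·L/2 chosen clusters have
distinct sizes.

First, equal sizes force a common edge (`exists_mem_of_ncard_eq`), and hence equality, since the
clusters form a laminar family. A cluster can be left downwards at only one node. If it stays away
from all lowest nodes, it contains its hanging paths completely, and the binary expansion of its
size reveals their exponents: two consecutive ones determine u and k (`exists_mem_of_inner`).
Otherwise it contains a whole right path at some lowest node. These paths grow by a factor of 4 from
block to block, so the size reveals the last block v whose lowest edges it contains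
(`eq_of_ncard_eq_of_max`).

Second, one cluster cannot be least for two pairs (`eq_of_separated`): its two children would have
to separate both pairs, which connectedness forbids. So the DAG has at least m²·L/2 nodes, which is
of order sσ. -/

theorem subtreeAt_append (T : BinaryTree Unit) (l p : TreePos) :
    subtreeAt T (l ++ p) = subtreeAt (subtreeAt T p) l := by
  induction l with
  | nil => rfl
  | cons d l ih => cases d <;> simp [subtreeAt, ih]

theorem subtreeAt_nil (l : TreePos) : subtreeAt BinaryTree.nil l = BinaryTree.nil := by
  induction l with
  | nil => rfl
  | cons d l ih => cases d <;> simp [subtreeAt, ih, BinaryTree.left, BinaryTree.right]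

theorem subtreeAt_ne_nil_of_suffix {T : BinaryTree Unit} {x y : TreePos} (h : x <:+ y)
    (hy : subtreeAt T y ≠ BinaryTree.nil) : subtreeAt T x ≠ BinaryTree.nil := by
  obtain ⟨l, rfl⟩ := h
  intro hx
  rw [subtreeAt_append, hx, subtreeAt_nil] at hy
  exact hy rfl

/-- The nodes of `T` in the subtree rooted at `p`. -/
def nodesBelow (T : BinaryTree Unit) (p : TreePos) : Set TreePos :=
  {x | p <:+ x ∧ subtreeAt T x ≠ BinaryTree.nil}

theorem nodes_finite_ncard (T : BinaryTree Unit) :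
    {l : TreePos | subtreeAt T l ≠ BinaryTree.nil}.Finite ∧
      {l : TreePos | subtreeAt T l ≠ BinaryTree.nil}.ncard = T.numNodes := by
  induction T with
  | nil => simp [subtreeAt_nil]
  | node a A B ihA ihB =>
    have hset : {l : TreePos | subtreeAt (BinaryTree.node a A B) l ≠ BinaryTree.nil} =
        insert [] ((fun l => l ++ [false]) '' {l : TreePos | subtreeAt A l ≠ BinaryTree.nil} ∪
          (fun l => l ++ [true]) '' {l : TreePos | subtreeAt B l ≠ BinaryTree.nil}) := by
      ext l
      rcases List.eq_nil_or_concat l with rfl | ⟨l, d, rfl⟩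
      · simp [subtreeAt]
      · cases d <;> simp [List.concat_eq_append, subtreeAt_append, subtreeAt,
          BinaryTree.left, BinaryTree.right]
    have injA : Function.Injective (fun l : TreePos => l ++ [false]) :=
      fun x y h => List.append_cancel_right h
    have injB : Function.Injective (fun l : TreePos => l ++ [true]) :=
      fun x y h => List.append_cancel_right h
    have fA := ihA.1.image (fun l : TreePos => l ++ [false])
    have fB := ihB.1.image (fun l : TreePos => l ++ [true])
    rw [hset]
    refine ⟨(fA.union fB).insert _, ?_⟩
    rw [Set.ncard_insert_of_notMem (by simp) (fA.union fB), Set.ncard_union_eq _ fA fB,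
      Set.ncard_image_of_injective _ injA, Set.ncard_image_of_injective _ injB, ihA.2, ihB.2]
    · simp
    · rw [Set.disjoint_left]
      rintro _ ⟨x, -, rfl⟩ ⟨y, -, h⟩
      simp at h

theorem nodesBelow_eq_image (T : BinaryTree Unit) (p : TreePos) :
    nodesBelow T p = (fun l => l ++ p) ''
      {l : TreePos | subtreeAt (subtreeAt T p) l ≠ BinaryTree.nil} := by
  ext x
  constructor
  · rintro ⟨⟨l, rfl⟩, h⟩
    exact ⟨l, by simpa [subtreeAt_append] using h, rfl⟩
  · rintro ⟨l, h, rfl⟩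
    exact ⟨List.suffix_append _ _, by simpa [subtreeAt_append] using h⟩

theorem nodesBelow_finite (T : BinaryTree Unit) (p : TreePos) : (nodesBelow T p).Finite := by
  rw [nodesBelow_eq_image]
  exact (nodes_finite_ncard _).1.image _

theorem ncard_nodesBelow (T : BinaryTree Unit) (p : TreePos) :
    (nodesBelow T p).ncard = (subtreeAt T p).numNodes := by
  rw [nodesBelow_eq_image, Set.ncard_image_of_injective, (nodes_finite_ncard _).2]
  exact fun x y h => List.append_cancel_right h

theorem treeEdges_eq (T : BinaryTree Unit) : treeEdges T = nodesBelow T [] \ {[]} := by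
  ext x
  simp [treeEdges, nodesBelow, and_comm]

theorem treeEdges_finite (T : BinaryTree Unit) : (treeEdges T).Finite := by
  rw [treeEdges_eq]
  exact (nodesBelow_finite T []).sdiff

theorem mem_treeEdges_of_suffix {T : BinaryTree Unit} {x y : TreePos} (h : x <:+ y) (hx : x ≠ [])
    (hy : y ∈ treeEdges T) : x ∈ treeEdges T :=
  ⟨hx, subtreeAt_ne_nil_of_suffix h hy.2⟩

theorem nodesBelow_subset_treeEdges {T : BinaryTree Unit} {p : TreePos} (hp : p ≠ []) :
    nodesBelow T p ⊆ treeEdges T := by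
  rintro x ⟨h, hx⟩
  refine ⟨?_, hx⟩
  rintro rfl
  exact hp (List.suffix_nil.1 h)

theorem suffix_tail_of_ne {z x : TreePos} (h : z <:+ x) (hne : z ≠ x) : z <:+ x.tail := by
  cases x with
  | nil => exact absurd (List.suffix_nil.1 h) hne
  | cons d x => exact (List.suffix_cons_iff.1 h).resolve_left hne

theorem exists_cons_suffix {z x : TreePos} (h : z <:+ x) (hne : z ≠ x) :
    ∃ d : Bool, (d :: z) <:+ x := by
  obtain ⟨l, rfl⟩ := h
  rcases List.eq_nil_or_concat l with rfl | ⟨l, d, rfl⟩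
  · simp at hne
  · exact ⟨d, l, by simp⟩

theorem not_cons_suffix_self (d : Bool) (z : TreePos) : ¬ (d :: z) <:+ z := fun h => by
  have := h.length_le
  simp at this

theorem cons_suffix_inj {d d' : Bool} {z x : TreePos} (h : (d :: z) <:+ x) (h' : (d' :: z) <:+ x) :
    d = d' := by
  have := (List.suffix_of_suffix_length_le h h' (by simp)).eq_of_length (by simp)
  simpa using this

/-! ### Clusters -/

/-- Passing to parents inside `E` shortens the position and can only stop at `r`. This turns the
local definition of connectedness into the statement about whole paths that is used later. -/
theorem IsTopNode.mem_of_suffix {E : Set TreePos} {r : TreePos} (h : IsTopNode E r)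
    (h0 : [] ∉ E) {x : TreePos} (hx : x ∈ E) :
    r <:+ x ∧ r ≠ x ∧ ∀ z, z <:+ x → r <:+ z → r ≠ z → z ∈ E := by
  induction x with
  | nil => exact absurd hx h0
  | cons d x ih =>
    rcases h.2 _ hx with hr | hr
    · simp only [List.tail_cons] at hr
      subst hr
      refine ⟨List.suffix_cons _ _, by simp, fun z hz hrz hne => ?_⟩
      rcases List.suffix_cons_iff.1 hz with rfl | hz
      · exact hx
      · exact absurd (hrz.eq_of_length (le_antisymm hrz.length_le hz.length_le)) hne
    · simp only [List.tail_cons] at hr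
      obtain ⟨h1, h2, h3⟩ := ih hr
      refine ⟨h1.trans (List.suffix_cons _ _), ?_, fun z hz hrz hne => ?_⟩
      · rintro rfl
        exact not_cons_suffix_self _ _ h1
      · rcases List.suffix_cons_iff.1 hz with rfl | hz
        · exact hx
        · exact h3 z hz hrz hne

namespace IsCluster

variable {T : BinaryTree Unit} {F : Set TreePos}

theorem nonempty (hF : IsCluster T F) : F.Nonempty := hF.connected.choose_spec.1

theorem finite (hF : IsCluster T F) : F.Finite := (treeEdges_finite T).subset hF.subset_edges

/-- The edge above `z` lies on the tree path joining `x` to `y`, and a cluster is connected. -/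
theorem mem_of_join (hF : IsCluster T F) {x y z : TreePos} (hx : x ∈ F) (hy : y ∈ F)
    (hzx : z <:+ x) (hzy : ¬ z <:+ y) : z ∈ F := by
  obtain ⟨r, hr⟩ := hF.connected
  have h0 : [] ∉ F := fun h => (hF.subset_edges h).1 rfl
  obtain ⟨h1, -, h3⟩ := hr.mem_of_suffix h0 hx
  obtain ⟨h1', -, -⟩ := hr.mem_of_suffix h0 hy
  rcases List.suffix_or_suffix_of_suffix hzx h1 with h | h
  · exact absurd (h.trans h1') hzy
  · refine h3 z hzx h ?_
    rintro rfl
    exact hzy h1'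

theorem mem_of_between (hF : IsCluster T F) {x y z : TreePos} (hx : x ∈ F) (hy : y ∈ F)
    (hxz : x <:+ z) (hzy : z <:+ y) : z ∈ F := by
  by_cases h : z = x
  · exact h ▸ hx
  · exact hF.mem_of_join hy hx hzy fun h' =>
      h (h'.eq_of_length (le_antisymm h'.length_le hxz.length_le))

/-- A bottom boundary node is a leaf of the cluster, so a non-top node with one child edge in the
cluster has all its child edges there. -/
theorem mem_child (hF : IsCluster T F) {x : TreePos} {d d' : Bool} (hx : x ∈ F)
    (hd : (d :: x) ∈ F) (hd' : (d' :: x) ∈ treeEdges T) : (d' :: x) ∈ F := by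
  by_contra h
  exact hF.bottom_leaf x ⟨hx, d', hd', h⟩ d hd

/-- The last edge of `F` on the way down from `x` to `y` ends in a bottom boundary node. -/
theorem exists_bottom (_hF : IsCluster T F) {x y : TreePos} (hx : x ∈ F) (hxy : x <:+ y)
    (hy : y ∈ treeEdges T) (hyF : y ∉ F) : ∃ b, IsBottomNode T F b ∧ x <:+ b ∧ b <:+ y := by
  induction y with
  | nil => exact absurd rfl hy.1
  | cons d y ih =>
    have hxy' : x <:+ y := by
      refine (List.suffix_cons_iff.1 hxy).resolve_left ?_
      rintro rfl
      exact hyF hx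
    by_cases hyF' : y ∈ F
    · exact ⟨y, ⟨hyF', d, hy, hyF⟩, hxy', List.suffix_cons _ _⟩
    · have hy0 : y ≠ [] := by
        rintro rfl
        rw [List.suffix_nil.1 hxy'] at hx
        exact hyF' hx
      obtain ⟨b, h1, h2, h3⟩ := ih hxy' (mem_treeEdges_of_suffix (List.suffix_cons _ _) hy0 hy) hyF'
      exact ⟨b, h1, h2, h3.trans (List.suffix_cons _ _)⟩

/-- Leaving the cluster below each of two incomparable edges would produce two different bottom
boundary nodes. This is the main tool for showing that clusters contain whole subtrees. -/
theorem mem_or_mem (hF : IsCluster T F) {x₁ x₂ y₁ y₂ : TreePos} (hx₁ : x₁ ∈ F) (hx₂ : x₂ ∈ F)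
    (h₁₂ : ¬ x₁ <:+ x₂) (h₂₁ : ¬ x₂ <:+ x₁) (h₁ : x₁ <:+ y₁) (h₂ : x₂ <:+ y₂)
    (hy₁ : y₁ ∈ treeEdges T) (hy₂ : y₂ ∈ treeEdges T) : y₁ ∈ F ∨ y₂ ∈ F := by
  by_contra! h
  obtain ⟨b₁, hb₁, hxb₁, -⟩ := hF.exists_bottom hx₁ h₁ hy₁ h.1
  obtain ⟨b₂, hb₂, hxb₂, -⟩ := hF.exists_bottom hx₂ h₂ hy₂ h.2
  obtain rfl := hF.bottom_unique _ _ hb₁ hb₂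
  exact (List.suffix_or_suffix_of_suffix hxb₁ hxb₂).elim h₁₂ h₂₁

end IsCluster

theorem isTopNode_singleton (d : Bool) (p : TreePos) : IsTopNode {d :: p} p :=
  ⟨⟨_, rfl⟩, by rintro _ rfl; exact Or.inl rfl⟩

theorem isCluster_singleton {T : BinaryTree Unit} {d : Bool} {p : TreePos}
    (hp : (d :: p) ∈ treeEdges T) : IsCluster T {d :: p} where
  subset_edges := by simpa using hp
  connected := ⟨p, isTopNode_singleton d p⟩
  bottom_leaf b hb d' h := by
    have h1 := hb.1
    simp only [Set.mem_singleton_iff] at h1 h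
    rw [h1] at h
    simp at h
  bottom_unique b b' hb hb' := by
    have h1 := hb.1
    have h2 := hb'.1
    simp only [Set.mem_singleton_iff] at h1 h2
    rw [h1, h2]

/-! ### The clusters of a top-tree -/

/-- The number of leaves of a top-tree. -/
def TopTree.leafCount : TopTree → ℕ
  | TopTree.edge _ => 1
  | TopTree.horizontal A B => A.leafCount + B.leafCount
  | TopTree.vertical A B => A.leafCount + B.leafCount

theorem TopTree.self_mem_subtrees (t : TopTree) : t ∈ t.subtrees := by
  cases t <;> simp [TopTree.subtrees]

/-- `𝓕` is the family of the clusters that correspond to the nodes of a top-tree `t` with root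
cluster `E`. -/
structure IsClusterFamily (T : BinaryTree Unit) (t : TopTree) (E : Set TreePos)
    (𝓕 : Set (Set TreePos)) : Prop where
  root_mem : E ∈ 𝓕
  subset_root : ∀ F ∈ 𝓕, F ⊆ E
  isCluster : ∀ F ∈ 𝓕, IsCluster T F
  exists_subtree : ∀ F ∈ 𝓕, ∃ t' ∈ t.subtrees, t'.leafCount = F.ncard
  laminar : ∀ F ∈ 𝓕, ∀ G ∈ 𝓕, F ⊆ G ∨ G ⊆ F ∨ Disjoint F G
  merge : ∀ F ∈ 𝓕, F.Subsingleton ∨ ∃ A ∈ 𝓕, ∃ B ∈ 𝓕, F = A ∪ B ∧ Disjoint A B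

theorem IsClusterFamily.union {T : BinaryTree Unit} {A B t : TopTree} {E F : Set TreePos}
    {𝓐 𝓑 : Set (Set TreePos)} (hA : IsClusterFamily T A E 𝓐) (hB : IsClusterFamily T B F 𝓑)
    (hd : Disjoint E F) (hc : IsCluster T (E ∪ F))
    (ht : t.subtrees = insert t (A.subtrees ∪ B.subtrees))
    (hl : t.leafCount = A.leafCount + B.leafCount)
    (hAl : A.leafCount = E.ncard) (hBl : B.leafCount = F.ncard) :
    IsClusterFamily T t (E ∪ F) (insert (E ∪ F) (𝓐 ∪ 𝓑)) where
  root_mem := Set.mem_insert _ _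
  subset_root := by
    rintro G (rfl | hG | hG)
    · exact subset_rfl
    · exact (hA.subset_root G hG).trans Set.subset_union_left
    · exact (hB.subset_root G hG).trans Set.subset_union_right
  isCluster := by
    rintro G (rfl | hG | hG)
    exacts [hc, hA.isCluster G hG, hB.isCluster G hG]
  exists_subtree := by
    rintro G (rfl | hG | hG)
    · refine ⟨t, t.self_mem_subtrees, ?_⟩
      rw [hl, hAl, hBl, Set.ncard_union_eq hd (hA.isCluster E hA.root_mem).finite
        (hB.isCluster F hB.root_mem).finite]
    · obtain ⟨t', h, h'⟩ := hA.exists_subtree G hG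
      exact ⟨t', by rw [ht]; simp [h], h'⟩
    · obtain ⟨t', h, h'⟩ := hB.exists_subtree G hG
      exact ⟨t', by rw [ht]; simp [h], h'⟩
  laminar := by
    have key : ∀ G ∈ insert (E ∪ F) (𝓐 ∪ 𝓑), G ⊆ E ∪ F := by
      rintro G (rfl | hG | hG)
      · exact subset_rfl
      · exact (hA.subset_root G hG).trans Set.subset_union_left
      · exact (hB.subset_root G hG).trans Set.subset_union_right
    rintro G (rfl | hG) H hH
    · exact Or.inr (Or.inl (key H hH))
    rcases hH with rfl | hH
    · exact Or.inl (key G (Or.inr hG))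
    rcases hG with hG | hG <;> rcases hH with hH | hH
    · exact hA.laminar G hG H hH
    · exact Or.inr (Or.inr (hd.mono (hA.subset_root G hG) (hB.subset_root H hH)))
    · exact Or.inr (Or.inr (hd.symm.mono (hB.subset_root G hG) (hA.subset_root H hH)))
    · exact hB.laminar G hG H hH
  merge := by
    rintro G (rfl | hG | hG)
    · exact Or.inr ⟨E, Or.inr (Or.inl hA.root_mem), F, Or.inr (Or.inr hB.root_mem), rfl, hd⟩
    · refine (hA.merge G hG).imp_right ?_
      rintro ⟨X, hX, Y, hY, h⟩
      exact ⟨X, Or.inr (Or.inl hX), Y, Or.inr (Or.inl hY), h⟩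
    · refine (hB.merge G hG).imp_right ?_
      rintro ⟨X, hX, Y, hY, h⟩
      exact ⟨X, Or.inr (Or.inr hX), Y, Or.inr (Or.inr hY), h⟩

theorem IsClusterTree.leafCount_eq {T : BinaryTree Unit} {t : TopTree} {E : Set TreePos}
    (h : IsClusterTree T t E) : E.Finite ∧ t.leafCount = E.ncard := by
  induction h with
  | edge d p hp => simp [TopTree.leafCount]
  | horizontal A B E F r _ _ hd _ _ _ ihA ihB =>
    exact ⟨ihA.1.union ihB.1, by
      rw [Set.ncard_union_eq hd ihA.1 ihB.1, TopTree.leafCount, ihA.2, ihB.2]⟩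
  | vertical A B E F b _ _ hd _ _ _ ihA ihB =>
    exact ⟨ihA.1.union ihB.1, by
      rw [Set.ncard_union_eq hd ihA.1 ihB.1, TopTree.leafCount, ihA.2, ihB.2]⟩

theorem IsClusterTree.exists_family {T : BinaryTree Unit} {t : TopTree} {E : Set TreePos}
    (h : IsClusterTree T t E) : ∃ 𝓕, IsClusterFamily T t E 𝓕 := by
  induction h with
  | edge d p hp =>
    refine ⟨{{d :: p}}, rfl, ?_, ?_, ?_, ?_, ?_⟩
    · rintro F rfl; exact subset_rfl
    · rintro F rfl; exact isCluster_singleton hp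
    · rintro F rfl; exact ⟨_, TopTree.self_mem_subtrees _, by simp [TopTree.leafCount]⟩
    · rintro F rfl G rfl; exact Or.inl subset_rfl
    · rintro F rfl; exact Or.inl Set.subsingleton_singleton
  | horizontal A B E F r hA hB hd _ _ hc ihA ihB =>
    obtain ⟨𝓐, h𝓐⟩ := ihA
    obtain ⟨𝓑, h𝓑⟩ := ihB
    exact ⟨_, h𝓐.union h𝓑 hd hc rfl rfl hA.leafCount_eq.2 hB.leafCount_eq.2⟩
  | vertical A B E F b hA hB hd _ _ hc ihA ihB =>
    obtain ⟨𝓐, h𝓐⟩ := ihA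
    obtain ⟨𝓑, h𝓑⟩ := ihB
    exact ⟨_, h𝓐.union h𝓑 hd hc rfl rfl hA.leafCount_eq.2 hB.leafCount_eq.2⟩

namespace IsClusterFamily

variable {T : BinaryTree Unit} {t : TopTree} {E : Set TreePos} {𝓕 : Set (Set TreePos)}

/-- A cluster of minimum size among those containing both edges meets every other such cluster, so
laminarity makes it the least one. -/
theorem exists_least (h : IsClusterFamily T t E 𝓕) {x y : TreePos} (hx : x ∈ E) (hy : y ∈ E) :
    ∃ F ∈ 𝓕, x ∈ F ∧ y ∈ F ∧ ∀ G ∈ 𝓕, x ∈ G → y ∈ G → F ⊆ G := by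
  obtain ⟨F, ⟨hF, hxF, hyF⟩, hmin⟩ := WellFounded.has_min (measure (Set.ncard (α := TreePos))).wf
    {F | F ∈ 𝓕 ∧ x ∈ F ∧ y ∈ F} ⟨E, h.root_mem, hx, hy⟩
  refine ⟨F, hF, hxF, hyF, fun G hG hxG hyG => ?_⟩
  rcases h.laminar F hF G hG with h' | h' | h'
  · exact h'
  · have := hmin G ⟨hG, hxG, hyG⟩
    have h2 : F.ncard ≤ G.ncard := not_lt.1 this
    exact (Set.eq_of_subset_of_ncard_le h' h2 (h.isCluster F hF).finite).symm.subset
  · exact absurd hxG (Set.disjoint_left.1 h' hxF)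

theorem eq_of_ncard_eq (h : IsClusterFamily T t E 𝓕) {F G : Set TreePos} (hF : F ∈ 𝓕) (hG : G ∈ 𝓕)
    (hc : F.ncard = G.ncard) {x : TreePos} (hxF : x ∈ F) (hxG : x ∈ G) : F = G := by
  rcases h.laminar F hF G hG with h' | h' | h'
  · exact Set.eq_of_subset_of_ncard_le h' hc.ge (h.isCluster G hG).finite
  · exact (Set.eq_of_subset_of_ncard_le h' hc.le (h.isCluster F hF).finite).symm
  · exact absurd hxG (Set.disjoint_left.1 h' hxF)

/-- Leaf counts of subtrees equal sizes of clusters, so the DAG has at least as many nodes as there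
are cluster sizes. The labels of the top-tree play no role. -/
theorem card_le_dagSize (h : IsClusterFamily T t E 𝓕) {ι : Type*} (I : Finset ι)
    (f : ι → Set TreePos) (hf : ∀ i ∈ I, f i ∈ 𝓕)
    (hinj : Set.InjOn (fun i => (f i).ncard) I) : I.card ≤ t.dagSize := by
  classical
  calc I.card = (I.image fun i => (f i).ncard).card := (Finset.card_image_of_injOn hinj).symm
    _ ≤ (t.subtrees.image TopTree.leafCount).card := by
      refine Finset.card_le_card fun n hn => ?_
      obtain ⟨i, hi, rfl⟩ := Finset.mem_image.1 hn
      obtain ⟨t', ht', hl⟩ := h.exists_subtree _ (hf i hi)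
      exact Finset.mem_image.2 ⟨t', ht', hl⟩
    _ ≤ t.dagSize := Finset.card_image_le

end IsClusterFamily

/-! ### Existence of top-trees -/

/-- The edges of `T` strictly below the node `p`. -/
def edgesBelow (T : BinaryTree Unit) (p : TreePos) : Set TreePos :=
  {x | (∃ d : Bool, (d :: p) <:+ x) ∧ x ∈ treeEdges T}

/-- A set of edges closed under passing to children has no bottom boundary node at all. -/
theorem isCluster_of_closed {T : BinaryTree Unit} {E : Set TreePos} {r : TreePos}
    (hE : E ⊆ treeEdges T) (hr : IsTopNode E r)
    (hclosed : ∀ x ∈ E, ∀ d : Bool, (d :: x) ∈ treeEdges T → (d :: x) ∈ E) : IsCluster T E where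
  subset_edges := hE
  connected := ⟨r, hr⟩
  bottom_leaf := by
    rintro b ⟨hb, d, hd, hd'⟩
    exact absurd (hclosed b hb d hd) hd'
  bottom_unique := by
    rintro b b' ⟨hb, d, hd, hd'⟩
    exact absurd (hclosed b hb d hd) hd'

/-- The edges of `T` at or below the node `d :: p`. -/
def edgesVia (T : BinaryTree Unit) (d : Bool) (p : TreePos) : Set TreePos :=
  {x | (d :: p) <:+ x ∧ x ∈ treeEdges T}

theorem edgesBelow_eq (T : BinaryTree Unit) (p : TreePos) :
    edgesBelow T p = edgesVia T false p ∪ edgesVia T true p := by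
  ext x
  simp only [edgesBelow, edgesVia, Bool.exists_bool, Set.mem_ofPred_eq, Set.mem_union]
  tauto

theorem edgesVia_eq {T : BinaryTree Unit} {d : Bool} {p : TreePos} (h : (d :: p) ∈ treeEdges T) :
    edgesVia T d p = edgesBelow T (d :: p) ∪ {d :: p} := by
  ext x
  simp only [edgesVia, edgesBelow, Set.mem_ofPred_eq, Set.mem_union, Set.mem_singleton_iff]
  constructor
  · rintro ⟨h1, h2⟩
    by_cases hx : d :: p = x
    · exact Or.inr hx.symm
    · exact Or.inl ⟨exists_cons_suffix h1 hx, h2⟩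
  · rintro (⟨⟨d', h1⟩, h2⟩ | rfl)
    · exact ⟨(List.suffix_cons _ _).trans h1, h2⟩
    · exact ⟨List.suffix_rfl, h⟩

theorem edgesVia_empty {T : BinaryTree Unit} {d : Bool} {p : TreePos}
    (h : (d :: p) ∉ treeEdges T) : edgesVia T d p = ∅ := by
  ext x
  simp only [edgesVia, Set.mem_ofPred_eq, Set.mem_empty_iff_false, iff_false]
  rintro ⟨h1, h2⟩
  exact h (mem_treeEdges_of_suffix h1 (by simp) h2)

theorem isTopNode_edgesVia {T : BinaryTree Unit} {d : Bool} {p : TreePos}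
    (h : (d :: p) ∈ treeEdges T) : IsTopNode (edgesVia T d p) p := by
  refine ⟨⟨_, List.suffix_rfl, h⟩, ?_⟩
  rintro x ⟨h1, h2⟩
  by_cases hx : d :: p = x
  · exact Or.inl (by rw [← hx]; rfl)
  · have h3 := suffix_tail_of_ne h1 hx
    exact Or.inr ⟨h3, mem_treeEdges_of_suffix (List.tail_suffix x)
      (fun h0 => by rw [h0] at h3; simp at h3) h2⟩

theorem isTopNode_union {E F : Set TreePos} {r : TreePos} (hE : IsTopNode E r)
    (hF : IsTopNode F r) : IsTopNode (E ∪ F) r := by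
  refine ⟨hE.1.mono Set.subset_union_left, ?_⟩
  rintro x (hx | hx)
  · exact (hE.2 x hx).imp_right Or.inl
  · exact (hF.2 x hx).imp_right Or.inr

theorem edgesVia_closed {T : BinaryTree Unit} {d : Bool} {p : TreePos} :
    ∀ x ∈ edgesVia T d p, ∀ d' : Bool, (d' :: x) ∈ treeEdges T → (d' :: x) ∈ edgesVia T d p :=
  fun _ hx _ hd => ⟨hx.1.trans (List.suffix_cons _ _), hd⟩

theorem isTopNode_edgesBelow {T : BinaryTree Unit} {p : TreePos} (h : (edgesBelow T p).Nonempty) :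
    IsTopNode (edgesBelow T p) p := by
  rw [edgesBelow_eq] at h ⊢
  by_cases hf : (false :: p) ∈ treeEdges T <;> by_cases ht : (true :: p) ∈ treeEdges T
  · exact isTopNode_union (isTopNode_edgesVia hf) (isTopNode_edgesVia ht)
  · rw [edgesVia_empty ht, Set.union_empty]
    exact isTopNode_edgesVia hf
  · rw [edgesVia_empty hf, Set.empty_union]
    exact isTopNode_edgesVia ht
  · rw [edgesVia_empty hf, edgesVia_empty ht] at h
    simp at h

theorem exists_clusterTree_edgesVia {T : BinaryTree Unit} {d : Bool} {p : TreePos}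
    (h : (d :: p) ∈ treeEdges T)
    (ih : (edgesBelow T (d :: p)).Nonempty → ∃ t, IsClusterTree T t (edgesBelow T (d :: p))) :
    ∃ t, IsClusterTree T t (edgesVia T d p) := by
  have hc := isCluster_of_closed (fun _ hx => hx.2) (isTopNode_edgesVia h) edgesVia_closed
  rw [edgesVia_eq h] at hc ⊢
  rcases (edgesBelow T (d :: p)).eq_empty_or_nonempty with he | hne
  · rw [he, Set.empty_union]
    exact ⟨_, IsClusterTree.edge d p h⟩
  · obtain ⟨t, ht⟩ := ih hne
    refine ⟨_, IsClusterTree.vertical t (TopTree.edge d) _ _ (d :: p) ht (IsClusterTree.edge d p h)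
      ?_ (isTopNode_edgesBelow hne) ⟨rfl, ?_⟩ hc⟩
    · rw [Set.disjoint_singleton_right]
      rintro ⟨⟨d', h'⟩, -⟩
      exact not_cons_suffix_self _ _ h'
    · obtain ⟨x, ⟨d', h1⟩, h2⟩ := hne
      exact ⟨d', mem_treeEdges_of_suffix h1 (by simp) h2, by simp⟩

/-- The top-tree is built bottom-up: the edges below a child are merged vertically with the edge to
that child, and the two sides of a node are then merged horizontally. All clusters that arise are
single edges or downward closed. -/
theorem exists_clusterTree_edgesBelow (T : BinaryTree Unit) (n : ℕ) :
    ∀ p, (subtreeAt T p).numNodes ≤ n → (edgesBelow T p).Nonempty →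
      ∃ t, IsClusterTree T t (edgesBelow T p) := by
  induction n with
  | zero =>
    rintro p hp ⟨x, ⟨d, h1⟩, h2⟩
    have := subtreeAt_ne_nil_of_suffix ((List.suffix_cons d p).trans h1) h2.2
    revert hp this
    cases subtreeAt T p <;> simp
  | succ n ih =>
    intro p hp hne
    have key : ∀ d, (d :: p) ∈ treeEdges T → ∃ t, IsClusterTree T t (edgesVia T d p) := by
      refine fun d hd => exists_clusterTree_edgesVia hd (ih _ ?_)
      have h1 := hd.2
      cases d <;> simp only [subtreeAt] at h1 ⊢ <;> revert hp h1 <;> cases subtreeAt T p <;>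
        simp [BinaryTree.left, BinaryTree.right] <;> intros <;> omega
    have hc := isCluster_of_closed (T := T) (E := edgesBelow T p) (fun _ hx => hx.2)
      (isTopNode_edgesBelow hne)
      (fun x hx d hd => ⟨hx.1.imp fun _ h => h.trans (List.suffix_cons _ _), hd⟩)
    rw [edgesBelow_eq] at hne hc ⊢
    by_cases hf : (false :: p) ∈ treeEdges T <;> by_cases ht : (true :: p) ∈ treeEdges T
    · obtain ⟨t₁, h₁⟩ := key _ hf
      obtain ⟨t₂, h₂⟩ := key _ ht
      refine ⟨_, IsClusterTree.horizontal t₁ t₂ _ _ p h₁ h₂ ?_ (isTopNode_edgesVia hf)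
        (isTopNode_edgesVia ht) hc⟩
      rw [Set.disjoint_left]
      rintro x ⟨hx, -⟩ ⟨hx', -⟩
      simpa using cons_suffix_inj hx hx'
    · rw [edgesVia_empty ht, Set.union_empty]
      exact key _ hf
    · rw [edgesVia_empty hf, Set.empty_union]
      exact key _ ht
    · rw [edgesVia_empty hf, edgesVia_empty ht] at hne
      simp at hne

theorem exists_isTopTree {T : BinaryTree Unit} (h : (treeEdges T).Nonempty) :
    ∃ t, IsTopTree T t := by
  have heq : treeEdges T = edgesBelow T [] := by
    ext x
    refine ⟨fun hx => ⟨exists_cons_suffix (List.nil_suffix) (Ne.symm hx.1), hx⟩, fun hx => hx.2⟩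
  rw [heq] at h
  obtain ⟨t, ht⟩ := exists_clusterTree_edgesBelow T _ [] le_rfl h
  exact ⟨t, by rw [IsTopTree, heq]; exact ht⟩

/-! ### Cartesian trees of the strings used in the construction -/

theorem foldl_min_mem (a : ℕ) (l : List ℕ) : l.foldl min a ∈ a :: l := by
  have h := firstMinIdx_lt a l
  unfold firstMinIdx at h
  exact List.idxOf_lt_length_iff.1 h

theorem foldl_min_le (a : ℕ) (l : List ℕ) : ∀ y ∈ a :: l, l.foldl min a ≤ y := by
  induction l generalizing a with
  | nil => simp
  | cons b l ih =>
    intro y hy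
    rw [List.foldl_cons]
    have h := ih (min a b)
    simp only [List.mem_cons] at hy h
    rcases hy with rfl | rfl | hy
    · exact (h _ (Or.inl rfl)).trans (min_le_left _ _)
    · exact (h _ (Or.inl rfl)).trans (min_le_right _ _)
    · exact h y (Or.inr hy)

/-- The root is the first minimum, hence the strict inequality on the left only. The weak one on the
right is why a run of equal letters becomes a right path. -/
theorem cartesianTree_append_cons {u v : List ℕ} {x : ℕ} (hu : ∀ y ∈ u, x < y)
    (hv : ∀ y ∈ v, x ≤ y) :
    cartesianTree (u ++ x :: v) = BinaryTree.node () (cartesianTree u) (cartesianTree v) := by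
  obtain ⟨a, l, hal⟩ : ∃ a l, u ++ x :: v = a :: l := by
    cases u with
    | nil => exact ⟨_, _, rfl⟩
    | cons b u => exact ⟨_, _, rfl⟩
  have hmin : l.foldl min a = x := by
    refine le_antisymm (foldl_min_le a l x (by rw [← hal]; simp)) ?_
    have h := foldl_min_mem a l
    rw [← hal, List.mem_append, List.mem_cons] at h
    rcases h with h | h | h
    · exact (hu _ h).le
    · exact h.ge
    · exact hv _ h
  have hidx : firstMinIdx a l = u.length := by
    rw [firstMinIdx, hmin, ← hal, List.idxOf_append_of_notMem fun h => (hu x h).false]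
    simp
  rw [hal, cartesianTree, hidx, ← hal]
  simp

theorem cartesianTree_nil : cartesianTree [] = BinaryTree.nil := by
  rw [cartesianTree]

/-- The path with `n` nodes all of whose edges lead to right children. -/
def rightPath : ℕ → BinaryTree Unit
  | 0 => BinaryTree.nil
  | n + 1 => BinaryTree.node () BinaryTree.nil (rightPath n)

theorem numNodes_rightPath (n : ℕ) : (rightPath n).numNodes = n := by
  induction n with
  | zero => rfl
  | succ n ih => simp [rightPath, ih]

theorem cartesianTree_replicate (n a : ℕ) : cartesianTree (List.replicate n a) = rightPath n := by
  induction n with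
  | zero => simpa [rightPath] using cartesianTree_nil
  | succ n ih =>
    have h := cartesianTree_append_cons (u := []) (v := List.replicate n a) (x := a) (by simp)
      (fun y hy => (List.eq_of_mem_replicate hy).ge)
    simpa [List.replicate_succ, rightPath, ih, cartesianTree_nil] using h

/-- A path with `n` edges that turns alternately left and right. A right path with `f r` nodes
hangs off the node at distance `r` from the lowest node of the path, and two right paths with `w`
nodes hang off the lowest node. -/
def zigzag (f : ℕ → ℕ) (w : ℕ) : ℕ → BinaryTree Unit
  | 0 => BinaryTree.node () (rightPath w) (rightPath w)
  | n + 1 =>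
    if Even (n + 1) then BinaryTree.node () (rightPath (f (n + 1))) (zigzag f w n)
    else BinaryTree.node () (zigzag f w n) (rightPath (f (n + 1)))

/-- The part before the center of a string whose Cartesian tree is a zigzag. -/
def zigzagPrefix (f : ℕ → ℕ) (L : ℕ) : ℕ → List ℕ
  | 0 => []
  | n + 1 =>
    if Even (n + 1) then
      List.replicate (f (n + 1)) (L + 2) ++ [L + 1 - (n + 1)] ++ zigzagPrefix f L n
    else zigzagPrefix f L n

/-- The part after the center of a string whose Cartesian tree is a zigzag. -/
def zigzagSuffix (f : ℕ → ℕ) (L : ℕ) : ℕ → List ℕ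
  | 0 => []
  | n + 1 =>
    if Even (n + 1) then zigzagSuffix f L n
    else zigzagSuffix f L n ++ ([L + 1 - (n + 1)] ++ List.replicate (f (n + 1)) (L + 2))

/-- The string `aʷ x aʷ`. -/
def twinRuns (a x w : ℕ) : List ℕ :=
  List.replicate w a ++ [x] ++ List.replicate w a

/-- A string whose Cartesian tree is a zigzag. -/
def zigzagString (f : ℕ → ℕ) (w L n : ℕ) : List ℕ :=
  zigzagPrefix f L n ++ twinRuns (L + 2) (L + 1) w ++ zigzagSuffix f L n

theorem mem_zigzagPrefix {f : ℕ → ℕ} {L n y : ℕ} (hn : n ≤ L) (hy : y ∈ zigzagPrefix f L n) :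
    L + 1 - n ≤ y ∧ y ≤ L + 2 := by
  induction n with
  | zero => simp [zigzagPrefix] at hy
  | succ n ih =>
    rw [zigzagPrefix] at hy
    split_ifs at hy
    · simp only [List.mem_append, List.mem_replicate, List.mem_singleton] at hy
      rcases hy with (hy | hy) | hy
      · omega
      · omega
      · have := ih (by omega) hy
        omega
    · have := ih (by omega) hy
      omega

theorem mem_zigzagSuffix {f : ℕ → ℕ} {L n y : ℕ} (hn : n ≤ L) (hy : y ∈ zigzagSuffix f L n) :
    L + 1 - n ≤ y ∧ y ≤ L + 2 := by
  induction n with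
  | zero => simp [zigzagSuffix] at hy
  | succ n ih =>
    rw [zigzagSuffix] at hy
    split_ifs at hy
    · have := ih (by omega) hy
      omega
    · simp only [List.mem_append, List.mem_replicate, List.mem_singleton] at hy
      rcases hy with hy | hy | hy
      · have := ih (by omega) hy
        omega
      · omega
      · omega

theorem mem_twinRuns {a x w y : ℕ} (hy : y ∈ twinRuns a x w) : y = a ∨ y = x := by
  simp only [twinRuns, List.mem_append, List.mem_replicate, List.mem_singleton] at hy
  tauto

theorem mem_zigzagString {f : ℕ → ℕ} {w L n y : ℕ} (hn : n ≤ L) (hy : y ∈ zigzagString f w L n) :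
    L + 1 - n ≤ y ∧ y ≤ L + 2 := by
  simp only [zigzagString, List.mem_append] at hy
  rcases hy with (hy | hy) | hy
  · exact mem_zigzagPrefix hn hy
  · have := mem_twinRuns hy
    omega
  · exact mem_zigzagSuffix hn hy

theorem cartesianTree_twinRuns {a x w : ℕ} (h : x < a) : cartesianTree (twinRuns a x w) =
    BinaryTree.node () (rightPath w) (rightPath w) := by
  rw [twinRuns, List.append_assoc, List.singleton_append, cartesianTree_append_cons,
    cartesianTree_replicate]
  · intro y hy; rw [List.eq_of_mem_replicate hy]; exact h
  · intro y hy; rw [List.eq_of_mem_replicate hy]; exact h.le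

theorem cartesianTree_zigzagString (f : ℕ → ℕ) (w : ℕ) {L n : ℕ} (hn : n ≤ L) :
    cartesianTree (zigzagString f w L n) = zigzag f w n := by
  induction n with
  | zero =>
    simp [zigzagString, zigzagPrefix, zigzagSuffix, zigzag, cartesianTree_twinRuns]
  | succ n ih =>
    have hmem : ∀ y ∈ zigzagString f w L n, L + 1 - (n + 1) < y := fun y hy => by
      have := mem_zigzagString (by omega) hy
      omega
    have hrep : ∀ y ∈ List.replicate (f (n + 1)) (L + 2), L + 1 - (n + 1) < y := fun y hy => by
      rw [List.eq_of_mem_replicate hy]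
      omega
    rw [zigzag, ← ih (by omega), ← cartesianTree_replicate _ (L + 2)]
    split_ifs with h
    · rw [← cartesianTree_append_cons hrep fun y hy => (hmem y hy).le]
      simp [zigzagString, zigzagPrefix, zigzagSuffix, h]
    · rw [← cartesianTree_append_cons hmem fun y hy => (hrep y hy).le]
      simp [zigzagString, zigzagPrefix, zigzagSuffix, h]

/-- A path with `n` edges to right children whose nodes have the left subtrees `B u`, `B (u + 1)`,
…, and whose lowest node has the subtree `R`. -/
def rightChain (B : ℕ → BinaryTree Unit) (R : BinaryTree Unit) : ℕ → ℕ → BinaryTree Unit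
  | 0, _ => R
  | n + 1, u => BinaryTree.node () (B u) (rightChain B R n (u + 1))

/-- The string `B u 0 B (u + 1) 0 … R` with `n` separators `0`. -/
def chainString (B : ℕ → List ℕ) (R : List ℕ) : ℕ → ℕ → List ℕ
  | 0, _ => R
  | n + 1, u => B u ++ [0] ++ chainString B R n (u + 1)

theorem cartesianTree_chainString {B : ℕ → List ℕ} (hB : ∀ u, ∀ y ∈ B u, 0 < y) (R : List ℕ)
    (n u : ℕ) : cartesianTree (chainString B R n u) =
      rightChain (fun u => cartesianTree (B u)) (cartesianTree R) n u := by
  induction n generalizing u with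
  | zero => rfl
  | succ n ih =>
    rw [chainString, rightChain, ← ih, List.append_assoc, List.singleton_append,
      cartesianTree_append_cons (hB u) fun y _ => y.zero_le]

theorem mem_chainString {B : ℕ → List ℕ} {R : List ℕ} {P : ℕ → Prop} (hB : ∀ u, ∀ y ∈ B u, P y)
    (hR : ∀ y ∈ R, P y) (h0 : P 0) (n u : ℕ) : ∀ y ∈ chainString B R n u, P y := by
  induction n generalizing u with
  | zero => exact hR
  | succ n ih =>
    intro y hy
    simp only [chainString, List.mem_append, List.mem_singleton] at hy
    rcases hy with (hy | rfl) | hy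
    exacts [hB u y hy, h0, ih _ y hy]

/-! ### Straight line programs from sets of strings -/

/-- The string `w` is empty, a single letter, or the concatenation of two nonempty strings
from `𝒲`. -/
def Splits {α : Type} (𝒲 : Finset (List α)) (w : List α) : Prop :=
  w = [] ∨ (∃ a, w = [a]) ∨ ∃ u ∈ 𝒲, ∃ v ∈ 𝒲, u ≠ [] ∧ v ≠ [] ∧ w = u ++ v

theorem Splits.append {α : Type} {𝒲 : Finset (List α)} {u v : List α} (hu : u ∈ 𝒲) (hv : v ∈ 𝒲)
    (su : Splits 𝒲 u) (sv : Splits 𝒲 v) : Splits 𝒲 (u ++ v) := by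
  rcases eq_or_ne u [] with rfl | hu0
  · simpa using sv
  rcases eq_or_ne v [] with rfl | hv0
  · simpa using su
  · exact Or.inr (Or.inr ⟨u, hu, v, hv, hu0, hv0, rfl⟩)

/-- The nonempty strings of `𝒲` serve as nonterminals, each with the rule given by its splitting.
Both parts are nonempty, so length decreases along rules and the grammar is acyclic. -/
theorem exists_slp_of_splits {α : Type} (𝒲 : Finset (List α)) (h𝒲 : ∀ w ∈ 𝒲, Splits 𝒲 w)
    {S : List α} (hS : S ∈ 𝒲) (hS0 : S ≠ []) {s : ℕ} (hs : 𝒲.card ≤ s) :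
    ∃ G : SLP α, G.Generates S ∧ G.size = s := by
  classical
  let V : Finset (List α) := 𝒲.filter (· ≠ [])
  have hV : V.card ≤ s := (Finset.card_filter_le _ _).trans hs
  have hrule : ∀ w : V, ∃ o : α ⊕ V × V,
      (∃ a, o = Sum.inl a ∧ w.1 = [a]) ∨ ∃ u v : V, o = Sum.inr (u, v) ∧ w.1 = u.1 ++ v.1 := by
    rintro ⟨w, hw⟩
    have hw' := Finset.mem_filter.1 hw
    rcases h𝒲 w hw'.1 with h | ⟨a, h⟩ | ⟨u, hu, v, hv, hu0, hv0, h⟩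
    · exact absurd h hw'.2
    · exact ⟨Sum.inl a, Or.inl ⟨a, rfl, h⟩⟩
    · exact ⟨_, Or.inr ⟨⟨u, Finset.mem_filter.2 ⟨hu, hu0⟩⟩, ⟨v, Finset.mem_filter.2 ⟨hv, hv0⟩⟩,
        rfl, h⟩⟩
  choose o ho using hrule
  have hpos : ∀ w : V, 0 < w.1.length := fun w =>
    List.length_pos_of_ne_nil (Finset.mem_filter.1 w.2).2
  -- The summand `Fin (s - V.card)` consists of unreachable dummy nonterminals that pad the size to
  -- exactly `s`; their terminal is arbitrary.
  let rule : V ⊕ Fin (s - V.card) → α ⊕ (V ⊕ Fin (s - V.card)) × (V ⊕ Fin (s - V.card)) :=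
    Sum.elim (fun w => (o w).map id (Prod.map Sum.inl Sum.inl)) (fun _ => Sum.inl (S.head hS0))
  have key : ∀ (w : V) (Y Z : V ⊕ Fin (s - V.card)), rule (Sum.inl w) = Sum.inr (Y, Z) →
      ∃ u v : V, Y = Sum.inl u ∧ Z = Sum.inl v ∧ w.1 = u.1 ++ v.1 := by
    intro w Y Z h
    rcases ho w with ⟨a, h1, h2⟩ | ⟨u, v, h1, h2⟩
    · simp [rule, h1] at h
    · simp only [rule, Sum.elim_inl, h1, Sum.map_inr, Prod.map_apply, Sum.inr.injEq,
        Prod.mk.injEq] at h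
      exact ⟨u, v, h.1.symm, h.2.symm, h2⟩
  let G : SLP α :=
    { N := V ⊕ Fin (s - V.card)
      finN := inferInstance
      rule := rule
      start := Sum.inl ⟨S, Finset.mem_filter.2 ⟨hS, hS0⟩⟩
      acyclic := by
        refine Subrelation.wf ?_
          (measure (Sum.elim (fun w : V => w.1.length) (fun _ : Fin (s - V.card) => 0))).wf
        rintro Y (w | x) ⟨Z, h⟩
        · rcases h with h | h
          · obtain ⟨u, v, rfl, rfl, h'⟩ := key w _ _ h
            have := hpos v
            simp [InvImage, WellFoundedRelation.rel, h']
            omega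
          · obtain ⟨u, v, rfl, rfl, h'⟩ := key w _ _ h
            have := hpos u
            simp [InvImage, WellFoundedRelation.rel, h']
            omega
        · simp [rule] at h }
  refine ⟨G, ?_, ?_⟩
  · have hder : ∀ (n : ℕ) (w : V), w.1.length ≤ n → G.Derives (Sum.inl w) w.1 := by
      intro n
      induction n with
      | zero => exact fun w hw => absurd (hpos w) (by omega)
      | succ n ih =>
        intro w hw
        rcases ho w with ⟨a, h1, h2⟩ | ⟨u, v, h1, h2⟩
        · rw [h2]
          exact SLP.Derives.terminal _ a (by simp [G, rule, h1])
        · have h3 := congrArg List.length h2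
          rw [List.length_append] at h3
          have := hpos u
          have := hpos v
          rw [h2]
          exact SLP.Derives.concat _ (Sum.inl u) (Sum.inl v) _ _ (by simp [G, rule, h1])
            (ih u (by omega)) (ih v (by omega))
    exact hder _ _ le_rfl
  · have : G.size = Fintype.card (V ⊕ Fin (s - V.card)) := rfl
    rw [this, Fintype.card_sum, Fintype.card_coe, Fintype.card_fin]
    omega

/-! ### The string and its straight line program -/

/-- Only the sizes at even heights enter the prefix, so it depends on `u / m` alone; likewise the
suffix depends on `u % m` alone. This is where the SLP saves a factor. -/
theorem zigzagPrefix_congr {f g : ℕ → ℕ} (h : ∀ r, Even r → f r = g r) (L n : ℕ) :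
    zigzagPrefix f L n = zigzagPrefix g L n := by
  induction n with
  | zero => rfl
  | succ n ih =>
    rw [zigzagPrefix, zigzagPrefix, ih]
    split_ifs with h'
    · rw [h _ h']
    · rfl

theorem zigzagSuffix_congr {f g : ℕ → ℕ} (h : ∀ r, ¬ Even r → f r = g r) (L n : ℕ) :
    zigzagSuffix f L n = zigzagSuffix g L n := by
  induction n with
  | zero => rfl
  | succ n ih =>
    rw [zigzagSuffix, zigzagSuffix, ih]
    split_ifs with h'
    · rfl
    · rw [h _ h']

/-- The binary logarithm of the size of the subtree that identifies the `r`-th position of the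
`v`-th half of a zigzag of length `L`. -/
def hangExp (L v r : ℕ) : ℕ := (L + 1) * (v + 1) + r

/-- The sizes of the subtrees that hang off the `u`-th zigzag, which is composed of the prefix
number `u / m` and the suffix number `u % m`. -/
def hangSize (L m u r : ℕ) : ℕ := 2 ^ hangExp L (if Even r then u / m else u % m) r

/-- The binary logarithm of the sizes of the two subtrees at the lowest node of the `u`-th
zigzag. -/
def centerExp (L m u : ℕ) : ℕ := (L + 1) * (m + 1) + L + 1 + 2 * u + 2

/-- The `u`-th zigzag string. -/
def blockString (L m u : ℕ) : List ℕ :=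
  zigzagString (hangSize L m u) (2 ^ centerExp L m u) L L

/-- The string whose Cartesian tree resists top-tree compression. -/
def hardString (L m : ℕ) : List ℕ :=
  chainString (blockString L m) (twinRuns (L + 2) 0 (2 ^ centerExp L m (m * m))) (m * m) 0

theorem chainString_ne_nil (B : ℕ → List ℕ) {R : List ℕ} (hR : R ≠ []) (n u : ℕ) :
    chainString B R n u ≠ [] := by
  cases n <;> simp [chainString, hR]

theorem pos_of_mem_blockString {L m u y : ℕ} (hy : y ∈ blockString L m u) : 0 < y := by
  have := (mem_zigzagString le_rfl hy).1
  omega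

theorem lt_of_mem_hardString {L m : ℕ} : ∀ y ∈ hardString L m, y < L + 3 := by
  refine mem_chainString (P := fun y => y < L + 3) (fun u y hy => ?_) (fun y hy => ?_)
    (by omega) _ _
  · have := (mem_zigzagString le_rfl hy).2
    omega
  · have := mem_twinRuns hy
    omega

set_option maxHeartbeats 1000000 in
-- The set consists of the letters, the runs of length 2ⁿ, four families of m(L+1) strings for the
-- prefixes and suffixes and their pieces, a bounded number of strings per block, the two strings at
-- the end, and the tails of the chain. The bound on `s` adds up these cardinalities.
theorem exists_slp_hardString {L m s : ℕ}
    (hs : 5 * (m * L) + 5 * m + 3 * L + 8 * (m * m) + 13 ≤ s) :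
    ∃ G : SLP ℕ, G.Generates (hardString L m) ∧ G.size = s := by
  obtain ⟨M, hM⟩ : ∃ M, M = m * m := ⟨_, rfl⟩
  set run : ℕ → List ℕ := fun n => List.replicate (2 ^ n) (L + 2) with hrun
  set R : List ℕ := twinRuns (L + 2) 0 (2 ^ centerExp L m M) with hR
  set P : ℕ := (L + 1) * (m + 1) + L + 2 * M + 4 with hP
  set g : ℕ → ℕ → ℕ := fun v r => 2 ^ hangExp L v r with hg
  set pre : ℕ → List ℕ := fun u => zigzagPrefix (hangSize L m u) L L with hpre
  set suf : ℕ → List ℕ := fun u => zigzagSuffix (hangSize L m u) L L with hsuf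
  set cen : ℕ → List ℕ := fun u => twinRuns (L + 2) (L + 1) (2 ^ centerExp L m u) with hcen
  obtain ⟨W1, hW1⟩ : ∃ W : Finset (List ℕ), W =
      (Finset.range (L + 3)).image fun b => [b] := ⟨_, rfl⟩
  obtain ⟨W2, hW2⟩ : ∃ W : Finset (List ℕ), W = (Finset.range P).image run := ⟨_, rfl⟩
  obtain ⟨W3, hW3⟩ : ∃ W : Finset (List ℕ), W = (Finset.range m ×ˢ Finset.range (L + 1)).image
    fun x => run (hangExp L x.1 x.2) ++ [L + 1 - x.2] := ⟨_, rfl⟩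
  obtain ⟨W4, hW4⟩ : ∃ W : Finset (List ℕ), W = (Finset.range m ×ˢ Finset.range (L + 1)).image
    fun x => [L + 1 - x.2] ++ run (hangExp L x.1 x.2) := ⟨_, rfl⟩
  obtain ⟨W5, hW5⟩ : ∃ W : Finset (List ℕ), W = (Finset.range m ×ˢ Finset.range (L + 1)).image
    fun x => zigzagPrefix (g x.1) L x.2 := ⟨_, rfl⟩
  obtain ⟨W6, hW6⟩ : ∃ W : Finset (List ℕ), W = (Finset.range m ×ˢ Finset.range (L + 1)).image
    fun x => zigzagSuffix (g x.1) L x.2 := ⟨_, rfl⟩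
  obtain ⟨W7, hW7⟩ : ∃ W : Finset (List ℕ), W = (Finset.range M).image
    fun u => run (centerExp L m u) ++ [L + 1] := ⟨_, rfl⟩
  obtain ⟨W8, hW8⟩ : ∃ W : Finset (List ℕ), W = (Finset.range M).image cen := ⟨_, rfl⟩
  obtain ⟨W9, hW9⟩ : ∃ W : Finset (List ℕ), W = {run (centerExp L m M) ++ [0], R} := ⟨_, rfl⟩
  obtain ⟨W10, hW10⟩ : ∃ W : Finset (List ℕ), W =
      (Finset.range M).image fun u => pre u ++ cen u := ⟨_, rfl⟩
  obtain ⟨W11, hW11⟩ : ∃ W : Finset (List ℕ), W =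
      (Finset.range M).image (blockString L m) := ⟨_, rfl⟩
  obtain ⟨W12, hW12⟩ : ∃ W : Finset (List ℕ), W =
      (Finset.range M).image fun u => blockString L m u ++ [0] := ⟨_, rfl⟩
  obtain ⟨W13, hW13⟩ : ∃ W : Finset (List ℕ), W = (Finset.range (M + 1)).image
    fun n => chainString (blockString L m) R n (M - n) := ⟨_, rfl⟩
  obtain ⟨𝒲, h𝒲⟩ : ∃ W : Finset (List ℕ), W =
      W1 ∪ (W2 ∪ (W3 ∪ (W4 ∪ (W5 ∪ (W6 ∪ (W7 ∪ (W8 ∪ (W9 ∪ (W10 ∪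
    (W11 ∪ (W12 ∪ W13))))))))))) := ⟨_, rfl⟩
  have hcard : 𝒲.card ≤ s := by
    have c1 : W1.card ≤ L + 3 := by rw [hW1]; exact Finset.card_image_le.trans (by simp)
    have c2 : W2.card ≤ P := by rw [hW2]; exact Finset.card_image_le.trans (by simp)
    have c3 : W3.card ≤ m * (L + 1) := by rw [hW3]; exact Finset.card_image_le.trans (by simp)
    have c4 : W4.card ≤ m * (L + 1) := by rw [hW4]; exact Finset.card_image_le.trans (by simp)
    have c5 : W5.card ≤ m * (L + 1) := by rw [hW5]; exact Finset.card_image_le.trans (by simp)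
    have c6 : W6.card ≤ m * (L + 1) := by rw [hW6]; exact Finset.card_image_le.trans (by simp)
    have c7 : W7.card ≤ M := by rw [hW7]; exact Finset.card_image_le.trans (by simp)
    have c8 : W8.card ≤ M := by rw [hW8]; exact Finset.card_image_le.trans (by simp)
    have c9 : W9.card ≤ 2 := by rw [hW9]; exact Finset.card_le_two
    have c10 : W10.card ≤ M := by rw [hW10]; exact Finset.card_image_le.trans (by simp)
    have c11 : W11.card ≤ M := by rw [hW11]; exact Finset.card_image_le.trans (by simp)
    have c12 : W12.card ≤ M := by rw [hW12]; exact Finset.card_image_le.trans (by simp)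
    have c13 : W13.card ≤ M + 1 := by rw [hW13]; exact Finset.card_image_le.trans (by simp)
    have hsum : 𝒲.card ≤ W1.card + (W2.card + (W3.card + (W4.card + (W5.card + (W6.card +
        (W7.card + (W8.card + (W9.card + (W10.card + (W11.card + (W12.card + W13.card))))))))))) := by
      rw [h𝒲]
      iterate 12 refine (Finset.card_union_le _ _).trans (Nat.add_le_add_left ?_ _)
      exact le_rfl
    rw [← hM] at hs
    have e1 : (L + 1) * (m + 1) = m * L + m + L + 1 := by ring
    have e2 : m * (L + 1) = m * L + m := by ring
    rw [e2] at c3 c4 c5 c6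
    rw [hP, e1] at c2
    omega
  have m1 : ∀ b < L + 3, [b] ∈ 𝒲 := fun b hb => by
    have : [b] ∈ W1 := by rw [hW1]; exact Finset.mem_image_of_mem _ (Finset.mem_range.2 hb)
    simp only [h𝒲, Finset.mem_union]; tauto
  have m2 : ∀ n < P, run n ∈ 𝒲 := fun n hn => by
    have : run n ∈ W2 := by rw [hW2]; exact Finset.mem_image_of_mem _ (Finset.mem_range.2 hn)
    simp only [h𝒲, Finset.mem_union]; tauto
  have mpair : ∀ v < m, ∀ r ≤ L, (v, r) ∈ Finset.range m ×ˢ Finset.range (L + 1) :=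
    fun v hv r hr => by simp; omega
  have m3 : ∀ v < m, ∀ r ≤ L, run (hangExp L v r) ++ [L + 1 - r] ∈ 𝒲 := fun v hv r hr => by
    have : run (hangExp L v r) ++ [L + 1 - r] ∈ W3 := by
      rw [hW3]; exact Finset.mem_image.2 ⟨(v, r), mpair v hv r hr, rfl⟩
    simp only [h𝒲, Finset.mem_union]; tauto
  have m4 : ∀ v < m, ∀ r ≤ L, [L + 1 - r] ++ run (hangExp L v r) ∈ 𝒲 := fun v hv r hr => by
    have : [L + 1 - r] ++ run (hangExp L v r) ∈ W4 := by
      rw [hW4]; exact Finset.mem_image.2 ⟨(v, r), mpair v hv r hr, rfl⟩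
    simp only [h𝒲, Finset.mem_union]; tauto
  have m5 : ∀ v < m, ∀ r ≤ L, zigzagPrefix (g v) L r ∈ 𝒲 := fun v hv r hr => by
    have : zigzagPrefix (g v) L r ∈ W5 := by
      rw [hW5]
      exact Finset.mem_image.2 ⟨(v, r), mpair v hv r hr, rfl⟩
    simp only [h𝒲, Finset.mem_union]; tauto
  have m6 : ∀ v < m, ∀ r ≤ L, zigzagSuffix (g v) L r ∈ 𝒲 := fun v hv r hr => by
    have : zigzagSuffix (g v) L r ∈ W6 := by
      rw [hW6]
      exact Finset.mem_image.2 ⟨(v, r), mpair v hv r hr, rfl⟩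
    simp only [h𝒲, Finset.mem_union]; tauto
  have m7 : ∀ u < M, run (centerExp L m u) ++ [L + 1] ∈ 𝒲 := fun u hu => by
    have : run (centerExp L m u) ++ [L + 1] ∈ W7 := by
      rw [hW7]; exact Finset.mem_image.2 ⟨u, Finset.mem_range.2 hu, rfl⟩
    simp only [h𝒲, Finset.mem_union]; tauto
  have m8 : ∀ u < M, cen u ∈ 𝒲 := fun u hu => by
    have : cen u ∈ W8 := by rw [hW8]; exact Finset.mem_image_of_mem _ (Finset.mem_range.2 hu)
    simp only [h𝒲, Finset.mem_union]; tauto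
  have m9 : run (centerExp L m M) ++ [0] ∈ 𝒲 ∧ R ∈ 𝒲 := by
    have h1 : run (centerExp L m M) ++ [0] ∈ W9 := by simp [hW9]
    have h2 : R ∈ W9 := by simp [hW9]
    constructor <;> simp only [h𝒲, Finset.mem_union] <;> tauto
  have m10 : ∀ u < M, pre u ++ cen u ∈ 𝒲 := fun u hu => by
    have : pre u ++ cen u ∈ W10 := by
      rw [hW10]
      exact Finset.mem_image.2 ⟨u, Finset.mem_range.2 hu, rfl⟩
    simp only [h𝒲, Finset.mem_union]; tauto
  have m11 : ∀ u < M, blockString L m u ∈ 𝒲 := fun u hu => by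
    have : blockString L m u ∈ W11 := by
      rw [hW11]
      exact Finset.mem_image_of_mem _ (Finset.mem_range.2 hu)
    simp only [h𝒲, Finset.mem_union]; tauto
  have m12 : ∀ u < M, blockString L m u ++ [0] ∈ 𝒲 := fun u hu => by
    have : blockString L m u ++ [0] ∈ W12 := by
      rw [hW12]
      exact Finset.mem_image.2 ⟨u, Finset.mem_range.2 hu, rfl⟩
    simp only [h𝒲, Finset.mem_union]; tauto
  have m13 : ∀ n ≤ M, chainString (blockString L m) R n (M - n) ∈ 𝒲 := fun n hn => by
    have : chainString (blockString L m) R n (M - n) ∈ W13 := by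
      rw [hW13]; exact Finset.mem_image.2 ⟨n, Finset.mem_range.2 (by omega), rfl⟩
    simp only [h𝒲, Finset.mem_union]; tauto
  have s1 : ∀ b, Splits 𝒲 [b] := fun b => Or.inr (Or.inl ⟨b, rfl⟩)
  have s2 : ∀ n < P, Splits 𝒲 (run n) := by
    intro n hn
    induction n with
    | zero => exact s1 (L + 2)
    | succ n ih =>
      -- Doubling: every run whose length is a power of two costs one additional rule.
      have : run (n + 1) = run n ++ run n := by
        simp only [hrun, pow_succ, mul_two, List.replicate_add]
      rw [this]
      exact Splits.append (m2 n (by omega)) (m2 n (by omega)) (ih (by omega)) (ih (by omega))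
  have hexp : ∀ v < m, ∀ r ≤ L, hangExp L v r < P := by
    intro v hv r hr
    have : (L + 1) * (v + 1) ≤ (L + 1) * (m + 1) := Nat.mul_le_mul_left _ (by omega)
    simp only [hangExp, hP]
    omega
  have hcexp : ∀ u ≤ M, centerExp L m u < P := by
    intro u hu
    simp only [centerExp, hP]
    omega
  have s3 : ∀ v < m, ∀ r ≤ L, Splits 𝒲 (run (hangExp L v r) ++ [L + 1 - r]) := fun v hv r hr =>
    Splits.append (m2 _ (hexp v hv r hr)) (m1 _ (by omega)) (s2 _ (hexp v hv r hr)) (s1 _)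
  have s4 : ∀ v < m, ∀ r ≤ L, Splits 𝒲 ([L + 1 - r] ++ run (hangExp L v r)) := fun v hv r hr =>
    Splits.append (m1 _ (by omega)) (m2 _ (hexp v hv r hr)) (s1 _) (s2 _ (hexp v hv r hr))
  have s5 : ∀ v < m, ∀ r ≤ L, Splits 𝒲 (zigzagPrefix (g v) L r) := by
    intro v hv r hr
    induction r with
    | zero => exact Or.inl rfl
    | succ r ih =>
      rw [zigzagPrefix]
      split_ifs
      · exact Splits.append (m3 v hv _ hr) (m5 v hv r (by omega)) (s3 v hv _ hr) (ih (by omega))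
      · exact ih (by omega)
  have s6 : ∀ v < m, ∀ r ≤ L, Splits 𝒲 (zigzagSuffix (g v) L r) := by
    intro v hv r hr
    induction r with
    | zero => exact Or.inl rfl
    | succ r ih =>
      rw [zigzagSuffix]
      split_ifs
      · exact ih (by omega)
      · exact Splits.append (m6 v hv r (by omega)) (m4 v hv _ hr) (ih (by omega)) (s4 v hv _ hr)
  have s7 : ∀ u < M, Splits 𝒲 (run (centerExp L m u) ++ [L + 1]) := fun u hu =>
    Splits.append (m2 _ (hcexp u hu.le)) (m1 _ (by omega)) (s2 _ (hcexp u hu.le)) (s1 _)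
  have s8 : ∀ u < M, Splits 𝒲 (cen u) := fun u hu =>
    Splits.append (m7 u hu) (m2 _ (hcexp u hu.le)) (s7 u hu) (s2 _ (hcexp u hu.le))
  have s9 : Splits 𝒲 (run (centerExp L m M) ++ [0]) :=
    Splits.append (m2 _ (hcexp M le_rfl)) (m1 _ (by omega)) (s2 _ (hcexp M le_rfl)) (s1 _)
  have s9' : Splits 𝒲 R :=
    Splits.append m9.1 (m2 _ (hcexp M le_rfl)) s9 (s2 _ (hcexp M le_rfl))
  have hdiv : ∀ u < M, u / m < m ∧ u % m < m := fun u hu => by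
    rw [hM] at hu
    have hm : 0 < m := Nat.pos_of_ne_zero fun h => by simp [h] at hu
    exact ⟨Nat.div_lt_of_lt_mul hu, Nat.mod_lt _ hm⟩
  have hpre_eq : ∀ u, pre u = zigzagPrefix (g (u / m)) L L := fun u =>
    zigzagPrefix_congr (fun r hr => by simp [hangSize, hg, hr]) _ _
  have hsuf_eq : ∀ u, suf u = zigzagSuffix (g (u % m)) L L := fun u =>
    zigzagSuffix_congr (fun r hr => by simp [hangSize, hg, hr]) _ _
  have s10 : ∀ u < M, Splits 𝒲 (pre u ++ cen u) := fun u hu => by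
    refine Splits.append ?_ (m8 u hu) ?_ (s8 u hu)
    · rw [hpre_eq]; exact m5 _ (hdiv u hu).1 _ le_rfl
    · rw [hpre_eq]; exact s5 _ (hdiv u hu).1 _ le_rfl
  have s11 : ∀ u < M, Splits 𝒲 (blockString L m u) := fun u hu => by
    refine Splits.append (v := suf u) (m10 u hu) ?_ (s10 u hu) ?_
    · rw [hsuf_eq]; exact m6 _ (hdiv u hu).2 _ le_rfl
    · rw [hsuf_eq]; exact s6 _ (hdiv u hu).2 _ le_rfl
  have s12 : ∀ u < M, Splits 𝒲 (blockString L m u ++ [0]) := fun u hu =>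
    Splits.append (m11 u hu) (m1 _ (by omega)) (s11 u hu) (s1 _)
  have s13 : ∀ n ≤ M, Splits 𝒲 (chainString (blockString L m) R n (M - n)) := by
    intro n hn
    induction n with
    | zero => exact s9'
    | succ n ih =>
      have h1 : M - (n + 1) + 1 = M - n := by omega
      rw [chainString, h1]
      exact Splits.append (m12 _ (by omega)) (m13 n (by omega)) (s12 _ (by omega)) (ih (by omega))
  refine exists_slp_of_splits 𝒲 ?_ (S := hardString L m) ?_ ?_ hcard
  · intro w hw
    simp only [h𝒲, Finset.mem_union] at hw
    rcases hw with hw | hw | hw | hw | hw | hw | hw | hw | hw | hw | hw | hw | hw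
    · rw [hW1] at hw
      obtain ⟨b, -, rfl⟩ := Finset.mem_image.1 hw
      exact s1 b
    · rw [hW2] at hw
      obtain ⟨n, hn, rfl⟩ := Finset.mem_image.1 hw
      exact s2 n (Finset.mem_range.1 hn)
    · rw [hW3] at hw
      obtain ⟨⟨v, r⟩, hn, rfl⟩ := Finset.mem_image.1 hw
      simp only [Finset.mem_product, Finset.mem_range] at hn
      exact s3 v hn.1 r (by omega)
    · rw [hW4] at hw
      obtain ⟨⟨v, r⟩, hn, rfl⟩ := Finset.mem_image.1 hw
      simp only [Finset.mem_product, Finset.mem_range] at hn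
      exact s4 v hn.1 r (by omega)
    · rw [hW5] at hw
      obtain ⟨⟨v, r⟩, hn, rfl⟩ := Finset.mem_image.1 hw
      simp only [Finset.mem_product, Finset.mem_range] at hn
      exact s5 v hn.1 r (by omega)
    · rw [hW6] at hw
      obtain ⟨⟨v, r⟩, hn, rfl⟩ := Finset.mem_image.1 hw
      simp only [Finset.mem_product, Finset.mem_range] at hn
      exact s6 v hn.1 r (by omega)
    · rw [hW7] at hw
      obtain ⟨u, hu, rfl⟩ := Finset.mem_image.1 hw
      exact s7 u (Finset.mem_range.1 hu)
    · rw [hW8] at hw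
      obtain ⟨u, hu, rfl⟩ := Finset.mem_image.1 hw
      exact s8 u (Finset.mem_range.1 hu)
    · simp only [hW9, Finset.mem_insert, Finset.mem_singleton] at hw
      rcases hw with rfl | rfl
      exacts [s9, s9']
    · rw [hW10] at hw
      obtain ⟨u, hu, rfl⟩ := Finset.mem_image.1 hw
      exact s10 u (Finset.mem_range.1 hu)
    · rw [hW11] at hw
      obtain ⟨u, hu, rfl⟩ := Finset.mem_image.1 hw
      exact s11 u (Finset.mem_range.1 hu)
    · rw [hW12] at hw
      obtain ⟨u, hu, rfl⟩ := Finset.mem_image.1 hw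
      exact s12 u (Finset.mem_range.1 hu)
    · rw [hW13] at hw
      obtain ⟨n, hn, rfl⟩ := Finset.mem_image.1 hw
      exact s13 n (Nat.lt_succ_iff.1 (Finset.mem_range.1 hn))
  · have := m13 M le_rfl
    rwa [Nat.sub_self, hR, hM] at this
  · exact chainString_ne_nil _ (by simp [twinRuns]) _ _

/-! ### Positions in a chain of zigzags -/

/-- The tree of `M` zigzags of length `L` that hang off a path to the right. -/
def zigzagChain (f : ℕ → ℕ → ℕ) (w : ℕ → ℕ) (L M : ℕ) : BinaryTree Unit :=
  rightChain (fun u => zigzag (f u) (w u) L)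
    (BinaryTree.node () (rightPath (w M)) (rightPath (w M))) M 0

/-- The position of the `u`-th node of the path to the right. -/
def sepPos (u : ℕ) : TreePos := List.replicate u true

/-- The position of the `t`-th node on the path of the `u`-th zigzag. -/
def spinePos (u : ℕ) : ℕ → TreePos
  | 0 => false :: sepPos u
  | t + 1 => decide (Even t) :: spinePos u t

/-- The root of the right path that hangs off the `t`-th node of the `u`-th zigzag. -/
def hangPos (u t : ℕ) : TreePos := (!decide (Even t)) :: spinePos u t

/-- The children of the lowest node of the `u`-th zigzag, or of the lowest node of the chain
if `u = M`. -/
def lowPos (L M u : ℕ) (d : Bool) : TreePos := d :: if u = M then sepPos M else spinePos u L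

theorem sepPos_succ (u : ℕ) : sepPos (u + 1) = true :: sepPos u := rfl

theorem sepPos_suffix {u v : ℕ} (h : u ≤ v) : sepPos u <:+ sepPos v := by
  obtain ⟨k, rfl⟩ := Nat.exists_eq_add_of_le h
  exact ⟨List.replicate k true, by simp [sepPos, List.replicate_append_replicate, Nat.add_comm]⟩

theorem length_sepPos (u : ℕ) : (sepPos u).length = u := by simp [sepPos]

theorem length_spinePos (u t : ℕ) : (spinePos u t).length = u + 1 + t := by
  induction t with
  | zero => simp [spinePos, length_sepPos]
  | succ t ih => simp [spinePos, ih]; omega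

theorem spinePos_suffix (u : ℕ) {t t' : ℕ} (h : t ≤ t') : spinePos u t <:+ spinePos u t' := by
  induction t', h using Nat.le_induction with
  | base => exact List.suffix_rfl
  | succ t' _ ih => exact ih.trans (List.suffix_cons _ _)

theorem sepPos_suffix_spinePos (u t : ℕ) : sepPos u <:+ spinePos u t :=
  (List.suffix_cons _ _).trans (spinePos_suffix u t.zero_le)

theorem false_mem_of_spinePos_suffix {u t : ℕ} {x : TreePos} (h : spinePos u t <:+ x) :
    false ∈ x :=
  ((spinePos_suffix u t.zero_le).trans h).subset (by simp [spinePos])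

theorem not_spinePos_suffix_sepPos (u t v : ℕ) : ¬ spinePos u t <:+ sepPos v := fun h => by
  have := false_mem_of_spinePos_suffix h
  simp [sepPos] at this

theorem sepPos_suffix_spinePos_iff {u v t : ℕ} : sepPos v <:+ spinePos u t ↔ v ≤ u := by
  constructor
  · intro h
    by_contra! hlt
    have h1 : sepPos (u + 1) <:+ spinePos u t := (sepPos_suffix hlt).trans h
    have h2 : spinePos u 0 <:+ spinePos u t := spinePos_suffix u t.zero_le
    simpa using cons_suffix_inj (x := spinePos u t) h1 h2
  · exact fun h => (sepPos_suffix h).trans (sepPos_suffix_spinePos u t)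

theorem eq_of_spinePos_suffix {u v t t' : ℕ} (h : spinePos u t <:+ spinePos v t') : u = v := by
  have h1 : u ≤ v := sepPos_suffix_spinePos_iff.1 ((sepPos_suffix_spinePos u t).trans h)
  by_contra hne
  have h2 : sepPos (u + 1) <:+ spinePos v t' := sepPos_suffix_spinePos_iff.2 (by omega)
  have h3 : spinePos u 0 <:+ spinePos v t' := (spinePos_suffix u t.zero_le).trans h
  simpa using cons_suffix_inj (x := spinePos v t') h2 h3

theorem le_of_spinePos_suffix {u t t' : ℕ} (h : spinePos u t <:+ spinePos u t') : t ≤ t' := by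
  have := h.length_le
  rw [length_spinePos, length_spinePos] at this
  omega

theorem not_hangPos_suffix_spinePos (u t t' : ℕ) : ¬ hangPos u t <:+ spinePos u t' := fun h => by
  have h1 := h.length_le
  simp only [hangPos, List.length_cons, length_spinePos] at h1
  have h2 : spinePos u (t + 1) <:+ spinePos u t' := spinePos_suffix u (by omega)
  simpa using cons_suffix_inj (x := spinePos u t') h2 h

theorem spinePos_suffix_hangPos {u t t' : ℕ} (h : spinePos u t' <:+ hangPos u t) : t' ≤ t := by
  rcases List.suffix_cons_iff.1 h with h | h
  · exact absurd (h ▸ List.suffix_rfl) (not_hangPos_suffix_spinePos u t t')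
  · exact le_of_spinePos_suffix h

theorem spinePos_suffix_hangPos_self (u t : ℕ) : spinePos u t <:+ hangPos u t :=
  List.suffix_cons _ _

theorem eq_of_hangPos_suffix {u t t' : ℕ} {x : TreePos} (h : hangPos u t <:+ x)
    (h' : hangPos u t' <:+ x) : t = t' := by
  wlog hlt : t ≤ t' generalizing t t'
  · exact (this h' h (by omega)).symm
  by_contra hne
  have h2 : spinePos u (t + 1) <:+ x :=
    ((spinePos_suffix u (by omega)).trans (spinePos_suffix_hangPos_self u t')).trans h'
  simpa using cons_suffix_inj h2 h

theorem lowPos_of_lt {L M u : ℕ} (h : u < M) (d : Bool) : lowPos L M u d = d :: spinePos u L := by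
  simp [lowPos, h.ne]

theorem lowPos_self (L M : ℕ) (d : Bool) : lowPos L M M d = d :: sepPos M := by simp [lowPos]

theorem sepPos_suffix_lowPos (L M u : ℕ) (d : Bool) : sepPos u <:+ lowPos L M u d := by
  rcases eq_or_ne u M with rfl | h
  · rw [lowPos_self]
    exact List.suffix_cons _ _
  · rw [lowPos, if_neg h]
    exact (sepPos_suffix_spinePos u L).trans (List.suffix_cons _ _)

/-- Walking down the spine towards `x`, one stops on it, turns off into a hanging path, or passes
its lowest node. -/
theorem cover_zigzag {L M u : ℕ} (hu : u < M) {x : TreePos} (h : spinePos u 0 <:+ x) :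
    (∃ t ≤ L, x = spinePos u t) ∨ (∃ t < L, hangPos u t <:+ x) ∨ ∃ d, lowPos L M u d <:+ x := by
  have key : ∀ n t, t + n = L → spinePos u t <:+ x → (∃ t ≤ L, x = spinePos u t) ∨
      (∃ t < L, hangPos u t <:+ x) ∨ ∃ d, lowPos L M u d <:+ x := by
    intro n
    induction n with
    | zero =>
      intro t ht h
      by_cases hx : spinePos u t = x
      · exact Or.inl ⟨t, by omega, hx.symm⟩
      · obtain ⟨d, hd⟩ := exists_cons_suffix h hx
        refine Or.inr (Or.inr ⟨d, ?_⟩)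
        rw [lowPos_of_lt hu]
        rwa [show L = t by omega]
    | succ n ih =>
      intro t ht h
      by_cases hx : spinePos u t = x
      · exact Or.inl ⟨t, by omega, hx.symm⟩
      · obtain ⟨d, hd⟩ := exists_cons_suffix h hx
        by_cases hd' : d = decide (Even t)
        · exact ih (t + 1) (by omega) (by rw [spinePos, ← hd']; exact hd)
        · refine Or.inr (Or.inl ⟨t, by omega, ?_⟩)
          rw [hangPos]
          rwa [show (!decide (Even t)) = d by revert hd'; cases d <;> cases decide (Even t) <;> simp]
  exact key L 0 (by omega) h

/-! ### Subtrees at the marked positions -/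

section Subtrees

variable {f : ℕ → ℕ → ℕ} {w : ℕ → ℕ} {L M : ℕ}

theorem subtreeAt_sepPos {u : ℕ} (hu : u ≤ M) : subtreeAt (zigzagChain f w L M) (sepPos u) =
    rightChain (fun u => zigzag (f u) (w u) L)
      (BinaryTree.node () (rightPath (w M)) (rightPath (w M))) (M - u) u := by
  induction u with
  | zero => rfl
  | succ u ih =>
    rw [sepPos_succ, subtreeAt, ih (by omega), show M - u = (M - (u + 1)) + 1 by omega]
    rfl

theorem subtreeAt_sepPos_of_lt {u : ℕ} (hu : u < M) : subtreeAt (zigzagChain f w L M) (sepPos u) =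
    BinaryTree.node () (zigzag (f u) (w u) L)
      (subtreeAt (zigzagChain f w L M) (sepPos (u + 1))) := by
  rw [subtreeAt_sepPos hu.le, subtreeAt_sepPos hu, show M - u = (M - (u + 1)) + 1 by omega]
  rfl

/-- Positions count depth from the top, while `zigzag` counts height from the bottom. Since `L` is
even, both have the same parity. -/
theorem subtreeAt_spinePos (hL : Even L) {u t : ℕ} (hu : u < M) (ht : t ≤ L) :
    subtreeAt (zigzagChain f w L M) (spinePos u t) = zigzag (f u) (w u) (L - t) := by
  induction t with
  | zero =>
    rw [spinePos, subtreeAt, subtreeAt_sepPos_of_lt hu]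
    rfl
  | succ t ih =>
    have hpar : Even (L - (t + 1) + 1) ↔ Even t := by
      rw [show L - (t + 1) + 1 = L - t by omega, Nat.even_sub (by omega)]
      simp [hL]
    have h := ih (by omega)
    rw [show L - t = L - (t + 1) + 1 by omega, zigzag] at h
    by_cases he : Even t
    · rw [if_pos (hpar.2 he)] at h
      simp [spinePos, he, subtreeAt, h, BinaryTree.right]
    · rw [if_neg (mt hpar.1 he)] at h
      simp [spinePos, he, subtreeAt, h, BinaryTree.left]

theorem subtreeAt_hangPos (hL : Even L) {u t : ℕ} (hu : u < M) (ht : t < L) :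
    subtreeAt (zigzagChain f w L M) (hangPos u t) = rightPath (f u (L - t)) := by
  have hpar : Even (L - (t + 1) + 1) ↔ Even t := by
    rw [show L - (t + 1) + 1 = L - t by omega, Nat.even_sub (by omega)]
    simp [hL]
  have h := subtreeAt_spinePos (f := f) (w := w) hL hu ht.le
  rw [show L - t = L - (t + 1) + 1 by omega, zigzag] at h
  rw [show L - t = L - (t + 1) + 1 by omega]
  by_cases he : Even t
  · rw [if_pos (hpar.2 he)] at h
    simp [hangPos, he, subtreeAt, h, BinaryTree.left]
  · rw [if_neg (mt hpar.1 he)] at h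
    simp [hangPos, he, subtreeAt, h, BinaryTree.right]

theorem subtreeAt_lowPos (hL : Even L) {u : ℕ} (hu : u ≤ M) (d : Bool) :
    subtreeAt (zigzagChain f w L M) (lowPos L M u d) = rightPath (w u) := by
  rcases hu.lt_or_eq with h | rfl
  · have h1 := subtreeAt_spinePos (f := f) (w := w) hL h le_rfl
    rw [Nat.sub_self, zigzag] at h1
    rw [lowPos_of_lt h]
    cases d <;> simp [subtreeAt, h1, BinaryTree.left, BinaryTree.right]
  · have h1 := subtreeAt_sepPos (f := f) (w := w) (L := L) hu
    rw [Nat.sub_self, rightChain] at h1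
    rw [lowPos_self]
    cases d <;> simp [subtreeAt, h1, BinaryTree.left, BinaryTree.right]

theorem rightPath_ne_nil {n : ℕ} (h : 0 < n) : rightPath n ≠ BinaryTree.nil := by
  cases n with
  | zero => omega
  | succ n => simp [rightPath]

theorem lowPos_mem_treeEdges (hL : Even L) (hw : ∀ u, 0 < w u) {u : ℕ} (hu : u ≤ M) (d : Bool) :
    lowPos L M u d ∈ treeEdges (zigzagChain f w L M) :=
  ⟨by simp [lowPos], by rw [subtreeAt_lowPos hL hu]; exact rightPath_ne_nil (hw u)⟩

theorem hangPos_mem_treeEdges (hL : Even L) (hf : ∀ u r, 0 < f u r) {u t : ℕ} (hu : u < M)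
    (ht : t < L) : hangPos u t ∈ treeEdges (zigzagChain f w L M) :=
  ⟨by simp [hangPos], by rw [subtreeAt_hangPos hL hu ht]; exact rightPath_ne_nil (hf _ _)⟩

theorem spinePos_ne_nil (u t : ℕ) : spinePos u t ≠ [] := by cases t <;> simp [spinePos]

theorem spinePos_mem_treeEdges (hL : Even L) (hw : ∀ u, 0 < w u) {u t : ℕ} (hu : u < M)
    (ht : t ≤ L) : spinePos u t ∈ treeEdges (zigzagChain f w L M) := by
  refine mem_treeEdges_of_suffix ?_ (spinePos_ne_nil u t) (lowPos_mem_treeEdges hL hw hu.le true)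
  rw [lowPos_of_lt hu]
  exact (spinePos_suffix u ht).trans (List.suffix_cons _ _)

theorem sepPos_mem_treeEdges (hL : Even L) (hw : ∀ u, 0 < w u) {u : ℕ} (hu : u < M) :
    sepPos (u + 1) ∈ treeEdges (zigzagChain f w L M) :=
  mem_treeEdges_of_suffix ((sepPos_suffix hu).trans (sepPos_suffix_lowPos L M M true))
    (by simp [sepPos_succ]) (lowPos_mem_treeEdges hL hw le_rfl true)

theorem numNodes_zigzag_le {f : ℕ → ℕ} {w n b : ℕ} (h : ∀ r ≤ n, f r ≤ b) :
    (zigzag f w n).numNodes ≤ n + 1 + n * b + 2 * w := by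
  induction n with
  | zero => simp [zigzag, numNodes_rightPath]; omega
  | succ n ih =>
    have h1 := ih fun r hr => h r (by omega)
    have h2 := h (n + 1) le_rfl
    have h3 : (n + 1) * b = n * b + b := by ring
    rw [zigzag]
    split_ifs <;> simp [numNodes_rightPath] <;> omega

end Subtrees

/-! ### Clusters of a chain of zigzags -/

/-- If `u ≠ u'`, each of `A` and `B` meets both zigzags and so contains the edge leading into zigzag
`u`, contradicting disjointness. On one zigzag the two intervals share at most an endpoint, and
whichever way `A` and `B` split them, one of the two has a gap on the spine. -/
theorem eq_of_separated {T : BinaryTree Unit} {A B : Set TreePos} (hA : IsCluster T A)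
    (hB : IsCluster T B) (hd : Disjoint A B) {u k u' k' : ℕ}
    (hx : spinePos u (2 * k) ∈ A ∪ B) (hy : spinePos u (2 * k + 2) ∈ A ∪ B)
    (hx' : spinePos u' (2 * k') ∈ A ∪ B) (hy' : spinePos u' (2 * k' + 2) ∈ A ∪ B)
    (h1 : ¬ (spinePos u (2 * k) ∈ A ∧ spinePos u (2 * k + 2) ∈ A))
    (h2 : ¬ (spinePos u (2 * k) ∈ B ∧ spinePos u (2 * k + 2) ∈ B))
    (h1' : ¬ (spinePos u' (2 * k') ∈ A ∧ spinePos u' (2 * k' + 2) ∈ A))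
    (h2' : ¬ (spinePos u' (2 * k') ∈ B ∧ spinePos u' (2 * k' + 2) ∈ B)) : u = u' ∧ k = k' := by
  have split : ∀ {x y : TreePos}, x ∈ A ∪ B → y ∈ A ∪ B → ¬ (x ∈ A ∧ y ∈ A) →
      ¬ (x ∈ B ∧ y ∈ B) → (x ∈ A ∧ y ∈ B) ∨ (x ∈ B ∧ y ∈ A) := by
    rintro x y (hx | hx) (hy | hy) hA hB
    exacts [absurd ⟨hx, hy⟩ hA, Or.inl ⟨hx, hy⟩, Or.inr ⟨hx, hy⟩, absurd ⟨hx, hy⟩ hB]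
  have hs := split hx hy h1 h2
  have hs' := split hx' hy' h1' h2'
  have huu : u = u' := by
    by_contra hne
    have key : ∀ {D : Set TreePos}, IsCluster T D → ∀ s s', spinePos u s ∈ D →
        spinePos u' s' ∈ D → spinePos u 0 ∈ D := fun hD s s' hs hs' =>
      hD.mem_of_join hs hs' (spinePos_suffix u s.zero_le) fun h => hne (eq_of_spinePos_suffix h)
    have hAB : ∀ {v j : ℕ}, (spinePos v (2 * j) ∈ A ∧ spinePos v (2 * j + 2) ∈ B) ∨
        (spinePos v (2 * j) ∈ B ∧ spinePos v (2 * j + 2) ∈ A) →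
        (∃ s, spinePos v s ∈ A) ∧ ∃ s, spinePos v s ∈ B := by
      rintro v j (⟨h, h'⟩ | ⟨h, h'⟩)
      exacts [⟨⟨_, h⟩, ⟨_, h'⟩⟩, ⟨⟨_, h'⟩, ⟨_, h⟩⟩]
    obtain ⟨⟨a, ha⟩, b, hb⟩ := hAB hs
    obtain ⟨⟨a', ha'⟩, b', hb'⟩ := hAB hs'
    exact Set.disjoint_left.1 hd (key hA a a' ha ha') (key hB b b' hb hb')
  subst huu
  refine ⟨rfl, ?_⟩
  by_contra hne
  have key : ∀ {k k' : ℕ}, k < k' → ∀ {A B : Set TreePos}, IsCluster T A → IsCluster T B →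
      Disjoint A B → spinePos u (2 * k) ∈ A → spinePos u (2 * k + 2) ∈ B →
      ((spinePos u (2 * k') ∈ A ∧ spinePos u (2 * k' + 2) ∈ B) ∨
        (spinePos u (2 * k') ∈ B ∧ spinePos u (2 * k' + 2) ∈ A)) → False := by
    intro k k' hlt A B hA hB hd hx hy h
    rcases h with ⟨h, h'⟩ | ⟨h, h'⟩
    · exact Set.disjoint_left.1 hd h (hB.mem_of_between hy h' (spinePos_suffix u (by omega))
        (spinePos_suffix u (by omega)))
    · exact Set.disjoint_left.1 hd (hA.mem_of_between hx h' (spinePos_suffix u (by omega))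
        (spinePos_suffix u (by omega))) hy
  rcases lt_or_gt_of_ne hne with hlt | hlt
  · rcases hs with ⟨h, h'⟩ | ⟨h, h'⟩
    · exact key hlt hA hB hd h h' hs'
    · exact key hlt hB hA hd.symm h h' hs'.symm
  · rcases hs' with ⟨h, h'⟩ | ⟨h, h'⟩
    · exact key hlt hA hB hd h h' hs
    · exact key hlt hB hA hd.symm h h' hs.symm

/-! ### What a cluster meeting a zigzag must contain -/

section Clusters

variable {f : ℕ → ℕ → ℕ} {w : ℕ → ℕ} {L M : ℕ} {F : Set TreePos} {u k : ℕ}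

theorem mem_spinePos_succ (hL : Even L) (hw : ∀ u, 0 < w u) (hF : IsCluster (zigzagChain f w L M) F)
    (hu : u < M) {t : ℕ} (ht : t < L) {d : Bool} (h : spinePos u t ∈ F)
    (hd : (d :: spinePos u t) ∈ F) : spinePos u (t + 1) ∈ F :=
  hF.mem_child h hd (spinePos_mem_treeEdges hL hw hu ht)

/-- A cluster that meets the zigzag `u` and the part of the tree below the separator `u + 1`
contains that separator. -/
theorem sepPos_mem_of_not_suffix (hL : Even L) (hw : ∀ u, 0 < w u)
    (hF : IsCluster (zigzagChain f w L M) F) (hu : u < M) {t : ℕ} (ht : spinePos u t ∈ F)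
    {x : TreePos} (hx : x ∈ F) (hxu : ¬ spinePos u 0 <:+ x) : sepPos (u + 1) ∈ F := by
  have h0 : spinePos u 0 ∈ F := hF.mem_of_join ht hx (spinePos_suffix u t.zero_le) hxu
  have hz : sepPos u ∈ F → sepPos (u + 1) ∈ F := fun h =>
    hF.mem_child h h0 (sepPos_mem_treeEdges hL hw hu)
  by_cases h1 : sepPos u <:+ x
  · by_cases h2 : sepPos u = x
    · exact hz (h2 ▸ hx)
    · obtain ⟨d, hd⟩ := exists_cons_suffix h1 h2
      cases d
      · exact absurd hd hxu
      · exact hF.mem_of_join hx h0 hd fun h => by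
          have := sepPos_suffix_spinePos_iff (v := u + 1).1 h
          omega
  · exact hz (hF.mem_of_join ht hx (sepPos_suffix_spinePos u t) h1)

/-- From the separator edge one can descend to the end of the chain, from the spine edge to the
bottom of zigzag `u`. The cluster cannot be left on both ways, so it would contain one of the
excluded low edges. -/
theorem sepPos_notMem (hL : Even L) (hw : ∀ u, 0 < w u) (hF : IsCluster (zigzagChain f w L M) F)
    (hu : u < M) {t : ℕ} (htL : t ≤ L) (ht : spinePos u t ∈ F)
    (hq : ∀ v ≤ M, lowPos L M v true ∉ F) : sepPos (u + 1) ∉ F := by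
  intro h
  rcases hF.mem_or_mem h ht (fun h => by
      have := sepPos_suffix_spinePos_iff.1 h
      omega) (not_spinePos_suffix_sepPos _ _ _)
      ((sepPos_suffix hu).trans (sepPos_suffix_lowPos L M M true))
      (y₂ := lowPos L M u true)
      (by rw [lowPos_of_lt hu]; exact (spinePos_suffix u htL).trans (List.suffix_cons _ _))
      (lowPos_mem_treeEdges hL hw le_rfl true) (lowPos_mem_treeEdges hL hw hu.le true) with h | h
  · exact hq M le_rfl h
  · exact hq u hu.le h

theorem spinePos_suffix_of_mem (hL : Even L) (hw : ∀ u, 0 < w u)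
    (hF : IsCluster (zigzagChain f w L M) F) (hu : u < M) {t : ℕ} (htL : t ≤ L)
    (ht : spinePos u t ∈ F) (hq : ∀ v ≤ M, lowPos L M v true ∉ F) {x : TreePos} (hx : x ∈ F) :
    spinePos u 0 <:+ x := by
  by_contra h
  exact sepPos_notMem hL hw hF hu htL ht hq (sepPos_mem_of_not_suffix hL hw hF hu ht hx h)

theorem hangPos_mem_of_suffix (hF : IsCluster (zigzagChain f w L M) F) {s t : ℕ}
    (ht : spinePos u s ∈ F) {x : TreePos} (hx : x ∈ F) (h : hangPos u t <:+ x) : hangPos u t ∈ F :=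
  hF.mem_of_join hx ht h (not_hangPos_suffix_spinePos u t s)

/-- The cluster is already left below the spine on the way to the lowest node, so it cannot also be
left inside the hanging path. -/
theorem nodesBelow_hangPos_subset (hL : Even L) (hw : ∀ u, 0 < w u)
    (hF : IsCluster (zigzagChain f w L M) F) (hu : u < M) {s t : ℕ} (hs : s ≤ L)
    (hsF : spinePos u s ∈ F) (ht : t < L) (htF : hangPos u t ∈ F)
    (hq : ∀ v ≤ M, lowPos L M v true ∉ F) :
    nodesBelow (zigzagChain f w L M) (hangPos u t) ⊆ F := by
  -- A spine edge below level `t` is needed, as only such an edge is incomparable with the hanging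
  -- path.
  have key : ∃ r, t < r ∧ r ≤ L ∧ spinePos u r ∈ F := by
    by_cases hst : s ≤ t
    · refine ⟨t + 1, by omega, ht, ?_⟩
      exact mem_spinePos_succ hL hw hF hu ht (hF.mem_of_between hsF htF (spinePos_suffix u hst)
        (spinePos_suffix_hangPos_self u t)) htF
    · exact ⟨s, by omega, hs, hsF⟩
  obtain ⟨r, htr, hrL, hr⟩ := key
  intro y hy
  refine (hF.mem_or_mem htF hr (not_hangPos_suffix_spinePos u t r) (fun h => ?_) hy.1
    (y₂ := lowPos L M u true)
    (by rw [lowPos_of_lt hu]; exact (spinePos_suffix u hrL).trans (List.suffix_cons _ _))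
    (nodesBelow_subset_treeEdges (by simp [hangPos]) hy)
    (lowPos_mem_treeEdges hL hw hu.le true)).resolve_right (hq u hu.le)
  have := spinePos_suffix_hangPos h
  omega

/-- Entering either path at the lowest node brings in both low edges by `mem_child`, whereas one of
them is excluded. -/
theorem lowPos_not_suffix (hL : Even L) (hw : ∀ u, 0 < w u)
    (hF : IsCluster (zigzagChain f w L M) F) (hu : u < M) {s : ℕ} (hs : s ≤ L)
    (hsF : spinePos u s ∈ F) (hq : ∀ v ≤ M, lowPos L M v true ∉ F) {x : TreePos} (hx : x ∈ F)
    (d : Bool) : ¬ lowPos L M u d <:+ x := by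
  intro h
  rw [lowPos_of_lt hu] at h
  have h1 : (d :: spinePos u L) ∈ F := hF.mem_of_join hx hsF h fun h' => by
    have := h'.length_le
    simp only [List.length_cons, length_spinePos] at this
    omega
  have h2 : spinePos u L ∈ F :=
    hF.mem_of_between hsF h1 (spinePos_suffix u hs) (List.suffix_cons _ _)
  have h3 := lowPos_mem_treeEdges (f := f) hL hw hu.le true
  refine hq u hu.le ?_
  rw [lowPos_of_lt hu] at h3 ⊢
  exact hF.mem_child h2 h1 h3

/-- The number of edges of a cluster that lies inside a zigzag. -/
theorem exists_ncard_eq (hL : Even L) (hw : ∀ u, 0 < w u)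
    (hF : IsCluster (zigzagChain f w L M) F) (hu : u < M) {s : ℕ} (hs : s ≤ L)
    (hsF : spinePos u s ∈ F) (hq : ∀ v ≤ M, lowPos L M v true ∉ F) :
    ∃ a ≤ L + 1, ∃ I : Finset ℕ, (∀ t, t ∈ I ↔ t < L ∧ hangPos u t ∈ F) ∧
      F.ncard = a + ∑ t ∈ I, f u (L - t) := by
  classical
  set T := zigzagChain f w L M with hT
  set I : Finset ℕ := (Finset.range L).filter fun t => hangPos u t ∈ F with hI
  have hIm : ∀ t, t ∈ I ↔ t < L ∧ hangPos u t ∈ F := fun t => by simp [hI]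
  set N : ℕ → Finset TreePos := fun t => (nodesBelow_finite T (hangPos u t)).toFinset with hN
  set Sp : Finset TreePos := ((Finset.range (L + 1)).image (spinePos u)).filter (· ∈ F) with hSp
  have hmN : ∀ t x, x ∈ N t ↔ x ∈ nodesBelow T (hangPos u t) := fun t x => by simp [hN]
  -- The cluster consists of some of the L + 1 spine edges and of complete hanging paths, each
  -- including the edge to its root.
  have heq : hF.finite.toFinset = Sp ∪ I.biUnion N := by
    ext x
    simp only [Set.Finite.mem_toFinset, Finset.mem_union, Finset.mem_biUnion]
    constructor
    · intro hx
      rcases cover_zigzag hu (spinePos_suffix_of_mem hL hw hF hu hs hsF hq hx) with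
        ⟨t, ht, rfl⟩ | ⟨t, ht, h⟩ | ⟨d, h⟩
      · exact Or.inl (Finset.mem_filter.2 ⟨Finset.mem_image_of_mem _ (by simp; omega), hx⟩)
      · exact Or.inr ⟨t, (hIm t).2 ⟨ht, hangPos_mem_of_suffix hF hsF hx h⟩,
          (hmN t x).2 ⟨h, (hF.subset_edges hx).2⟩⟩
      · exact absurd h (lowPos_not_suffix hL hw hF hu hs hsF hq hx d)
    · rintro (hx | ⟨t, ht, hx⟩)
      · exact (Finset.mem_filter.1 hx).2
      · have ht' := (hIm t).1 ht
        exact nodesBelow_hangPos_subset hL hw hF hu hs hsF ht'.1 ht'.2 hq ((hmN t x).1 hx)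
  refine ⟨Sp.card, ?_, I, hIm, ?_⟩
  · exact (Finset.card_filter_le _ _).trans (Finset.card_image_le.trans (by simp))
  · rw [Set.ncard_eq_toFinset_card F hF.finite, heq, Finset.card_union_of_disjoint,
      Finset.card_biUnion]
    · congr 1
      refine Finset.sum_congr rfl fun t ht => ?_
      rw [← Set.ncard_eq_toFinset_card _ (nodesBelow_finite T (hangPos u t)), ncard_nodesBelow,
        subtreeAt_hangPos hL hu ((hIm t).1 ht).1, numNodes_rightPath]
    · intro t _ t' _ hne
      rw [Function.onFun, Finset.disjoint_left]
      intro x hx hx'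
      exact hne (eq_of_hangPos_suffix ((hmN t x).1 hx).1 ((hmN t' x).1 hx').1)
    · rw [Finset.disjoint_left]
      intro x hx hx'
      obtain ⟨t, -, rfl⟩ := Finset.mem_image.1 (Finset.mem_filter.1 hx).1
      obtain ⟨t', -, h⟩ := Finset.mem_biUnion.1 hx'
      exact not_hangPos_suffix_spinePos _ _ _ ((hmN _ _).1 h).1

theorem hangPos_mem_of_spinePos_mem (hL : Even L) (hf : ∀ u r, 0 < f u r)
    (hF : IsCluster (zigzagChain f w L M) F) (hu : u < M) (hk : 2 * k + 2 ≤ L)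
    (hx : spinePos u (2 * k) ∈ F) (hy : spinePos u (2 * k + 2) ∈ F) :
    hangPos u (2 * k) ∈ F ∧ hangPos u (2 * k + 1) ∈ F := by
  have hm : spinePos u (2 * k + 1) ∈ F := hF.mem_of_between hx hy (spinePos_suffix u (by omega))
    (spinePos_suffix u (by omega))
  exact ⟨hF.mem_child hx hm (hangPos_mem_treeEdges hL hf hu (by omega)),
    hF.mem_child hm hy (hangPos_mem_treeEdges hL hf hu (by omega))⟩

/-- The cluster contains both low edges of `v` and can be left below only one of them, so one of the
two right paths with `w v` nodes lies in it. The strict bound `s < L` keeps the lowest node from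
being an ancestor of, or equal to, the given spine node. -/
theorem le_ncard_of_lowPos_mem (hL : Even L) (hw : ∀ u, 0 < w u)
    (hF : IsCluster (zigzagChain f w L M) F) (hu : u < M) {s : ℕ} (hs : s < L)
    (hsF : spinePos u s ∈ F) {v : ℕ} (hv : v ≤ M) (hq : lowPos L M v true ∈ F) :
    w v ≤ F.ncard := by
  obtain ⟨c, hc, hcne, hsuf⟩ : ∃ c, (∀ d, lowPos L M v d = d :: c) ∧ ¬ c <:+ spinePos u s ∧
      c <:+ lowPos L M v true := by
    refine ⟨_, fun d => rfl, ?_, List.suffix_cons _ _⟩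
    rcases eq_or_ne v M with rfl | h
    · simp only [if_true]
      intro h
      have := sepPos_suffix_spinePos_iff.1 h
      omega
    · rw [if_neg h]
      intro h'
      obtain rfl := eq_of_spinePos_suffix h'
      have := le_of_spinePos_suffix h'
      omega
  have hcF : c ∈ F := hF.mem_of_join hq hsF hsuf hcne
  have hqf : lowPos L M v false ∈ F := by
    have h := lowPos_mem_treeEdges (f := f) hL hw hv false
    rw [hc] at hq h ⊢
    exact hF.mem_child hcF hq h
  have hbig : ∀ d, nodesBelow (zigzagChain f w L M) (lowPos L M v d) ⊆ F → w v ≤ F.ncard := by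
    intro d h
    have h1 := Set.ncard_le_ncard h hF.finite
    rwa [ncard_nodesBelow, subtreeAt_lowPos hL hv, numNodes_rightPath] at h1
  by_cases hall : nodesBelow (zigzagChain f w L M) (lowPos L M v true) ⊆ F
  · exact hbig true hall
  · refine hbig false fun y hy => ?_
    obtain ⟨y', hy', hy'F⟩ := Set.not_subset.1 hall
    have hn : ∀ d d', d ≠ d' → ¬ lowPos L M v d <:+ lowPos L M v d' := by
      intro d d' hne h
      rw [hc, hc] at h
      exact hne (cons_suffix_inj h List.suffix_rfl)
    refine (hF.mem_or_mem hqf hq (hn _ _ (by simp)) (hn _ _ (by simp)) hy.1 hy'.1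
      (nodesBelow_subset_treeEdges (by simp [lowPos]) hy)
      (nodesBelow_subset_treeEdges (by simp [lowPos]) hy')).resolve_right hy'F

/-- If `v` is the last zigzag whose lowest edges belong to a cluster, then the cluster contains
nothing strictly below the next separator. -/
theorem not_cons_sepPos_suffix (hL : Even L) (hw : ∀ u, 0 < w u)
    (hF : IsCluster (zigzagChain f w L M) F) {v : ℕ} (hv : v < M)
    (hq : lowPos L M v true ∈ F) (hmax : ∀ v' ≤ M, v < v' → lowPos L M v' true ∉ F) {x : TreePos}
    (hx : x ∈ F) (d : Bool) : ¬ (d :: sepPos (v + 1)) <:+ x := by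
  intro h
  have hqn : ¬ sepPos (v + 1) <:+ lowPos L M v true := by
    rw [lowPos_of_lt hv]
    intro h'
    have h2 : spinePos v 0 <:+ true :: spinePos v L :=
      (spinePos_suffix v L.zero_le).trans (List.suffix_cons _ _)
    simpa using cons_suffix_inj h' h2
  have hz : sepPos (v + 1) ∈ F := hF.mem_of_join hx hq ((List.suffix_cons _ _).trans h) hqn
  have hd : (d :: sepPos (v + 1)) ∈ F := hF.mem_of_between hz hx (List.suffix_cons _ _) h
  rcases (show v + 1 ≤ M from hv).eq_or_lt with heq | hlt
  · have h1 := lowPos_mem_treeEdges (f := f) hL hw (le_refl M) true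
    refine hmax M le_rfl hv ?_
    rw [lowPos_self, ← heq] at h1 ⊢
    subst heq
    exact hF.mem_child hz hd h1
  · have h1 : spinePos (v + 1) 0 ∈ F :=
      hF.mem_child hz hd (spinePos_mem_treeEdges hL hw hlt L.zero_le)
    have h2 : sepPos (v + 2) ∈ F := hF.mem_child hz hd (sepPos_mem_treeEdges hL hw hlt)
    rcases hF.mem_or_mem h1 h2 (not_spinePos_suffix_sepPos _ _ _)
      (fun h => by
        have := sepPos_suffix_spinePos_iff.1 h
        omega)
      (y₁ := lowPos L M (v + 1) true)
      (by rw [lowPos_of_lt hlt]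
          exact (spinePos_suffix _ L.zero_le).trans (List.suffix_cons _ _))
      ((sepPos_suffix hlt).trans (sepPos_suffix_lowPos L M M true))
      (lowPos_mem_treeEdges hL hw hlt.le true) (lowPos_mem_treeEdges hL hw le_rfl true) with h | h
    · exact hmax _ hlt.le (by omega) h
    · exact hmax M le_rfl hv h

/-- Block `u` together with its separator has at most 3·w(u) nodes. Since w(u+1) = w(u) + 3·w(u),
these bounds telescope to less than 4·w(v). -/
theorem numNodes_zigzagChain_le (hw0 : 2 ≤ w 0) (hw4 : ∀ u, w (u + 1) = 4 * w u)
    (hz : ∀ u < M, 1 + (zigzag (f u) (w u) L).numNodes ≤ 3 * w u) {v : ℕ} (hv : v < M) :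
    (zigzagChain f w L M).numNodes + 2 ≤
      (subtreeAt (zigzagChain f w L M) (sepPos (v + 1))).numNodes + 4 * w v := by
  have hstep : ∀ v < M, (subtreeAt (zigzagChain f w L M) (sepPos v)).numNodes =
      (zigzag (f v) (w v) L).numNodes +
        (subtreeAt (zigzagChain f w L M) (sepPos (v + 1))).numNodes + 1 := fun v hv => by
    rw [subtreeAt_sepPos_of_lt hv, BinaryTree.numNodes]
  induction v with
  | zero =>
    have h1 := hstep 0 hv
    have h2 := hz 0 hv
    have h3 : subtreeAt (zigzagChain f w L M) (sepPos 0) = zigzagChain f w L M := rfl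
    rw [h3] at h1
    omega
  | succ v ih =>
    have h1 := hstep (v + 1) hv
    have h2 := hz (v + 1) hv
    have h3 := ih (by omega)
    have h4 := hw4 v
    omega

/-- The cluster avoids everything strictly below separator `v + 1`, and the rest of the tree has
fewer than 4·w(v) = w(v+1) edges. -/
theorem ncard_lt_of_max (hL : Even L) (hw : ∀ u, 0 < w u) (hw0 : 2 ≤ w 0)
    (hw4 : ∀ u, w (u + 1) = 4 * w u)
    (hz : ∀ u < M, 1 + (zigzag (f u) (w u) L).numNodes ≤ 3 * w u)
    (hF : IsCluster (zigzagChain f w L M) F) {v : ℕ} (hv : v < M)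
    (hq : lowPos L M v true ∈ F) (hmax : ∀ v' ≤ M, v < v' → lowPos L M v' true ∉ F) :
    F.ncard < w (v + 1) := by
  set T := zigzagChain f w L M with hT
  set D := nodesBelow T (sepPos (v + 1)) \ {sepPos (v + 1)} with hD
  have hfin := nodesBelow_finite T (sepPos (v + 1))
  have hedge := sepPos_mem_treeEdges (f := f) hL hw hv
  have hmem : sepPos (v + 1) ∈ nodesBelow T (sepPos (v + 1)) := ⟨List.suffix_rfl, hedge.2⟩
  have hDc : D.ncard + 1 = (subtreeAt T (sepPos (v + 1))).numNodes := by
    rw [← ncard_nodesBelow, hD, Set.ncard_sdiff_singleton_add_one hmem hfin]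
  have hdis : Disjoint F D := by
    rw [Set.disjoint_left]
    rintro x hx ⟨⟨hx1, -⟩, hx2⟩
    obtain ⟨d, hd⟩ := exists_cons_suffix hx1 (Ne.symm hx2)
    exact not_cons_sepPos_suffix hL hw hF hv hq hmax hx d hd
  have hsub : F ∪ D ⊆ treeEdges T :=
    Set.union_subset hF.subset_edges
      (Set.sdiff_subset.trans (nodesBelow_subset_treeEdges hedge.1))
  have h1 := Set.ncard_le_ncard hsub (treeEdges_finite T)
  rw [Set.ncard_union_eq hdis hF.finite hfin.sdiff] at h1
  have h2 : (treeEdges T).ncard ≤ T.numNodes := by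
    rw [treeEdges_eq]
    refine (Set.ncard_le_ncard Set.sdiff_subset (nodesBelow_finite T [])).trans ?_
    rw [ncard_nodesBelow]
    rfl
  have h3 := numNodes_zigzagChain_le (M := M) (L := L) (f := f) hw0 hw4 hz hv
  rw [hw4]
  rw [← hT] at h3
  omega

end Clusters

/-! ### The lower bound -/

/-- Reduction modulo 2ᶜ isolates the low parts; the high parts are binary expansions, which are
unique. -/
theorem eq_of_add_sum_two_pow_eq {a b c : ℕ} {I J : Finset ℕ} (ha : a < 2 ^ c) (hb : b < 2 ^ c)
    (hI : ∀ i ∈ I, c ≤ i) (hJ : ∀ i ∈ J, c ≤ i)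
    (h : a + ∑ i ∈ I, 2 ^ i = b + ∑ i ∈ J, 2 ^ i) : I = J := by
  have hdvd : ∀ K : Finset ℕ, (∀ i ∈ K, c ≤ i) → ∃ q, ∑ i ∈ K, 2 ^ i = 2 ^ c * q := fun K hK =>
    Finset.dvd_sum fun i hi => pow_dvd_pow 2 (hK i hi)
  obtain ⟨q, hq⟩ := hdvd I hI
  obtain ⟨q', hq'⟩ := hdvd J hJ
  have hab : a = b := by
    rw [hq, hq'] at h
    have := congrArg (· % 2 ^ c) h
    simpa [Nat.add_mul_mod_self_left, Nat.mod_eq_of_lt ha, Nat.mod_eq_of_lt hb] using this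
  subst hab
  exact Finset.geomSum_injective le_rfl (Nat.add_left_cancel h)

theorem exists_max_le {Q : ℕ → Prop} {M : ℕ} (h : ∃ v ≤ M, Q v) :
    ∃ v ≤ M, Q v ∧ ∀ v' ≤ M, v < v' → ¬ Q v' := by
  classical
  obtain ⟨v, hv, hQ⟩ := h
  exact ⟨Nat.findGreatest Q M, Nat.findGreatest_le M, Nat.findGreatest_spec hv hQ,
    fun v' hv' hlt => Nat.findGreatest_is_greatest hlt hv'⟩

theorem hangExp_inj {L v v' r r' : ℕ} (hr : r ≤ L) (hr' : r' ≤ L)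
    (h : hangExp L v r = hangExp L v' r') : v = v' ∧ r = r' := by
  unfold hangExp at h
  have h1 : r = r' := by
    have := congrArg (· % (L + 1)) h
    simpa [Nat.mul_add_mod, Nat.mod_eq_of_lt (Nat.lt_succ_of_le hr),
      Nat.mod_eq_of_lt (Nat.lt_succ_of_le hr')] using this
  subst h1
  have h2 := Nat.eq_of_mul_eq_mul_left (Nat.succ_pos L) (Nat.add_right_cancel h)
  exact ⟨by omega, rfl⟩

/-- The exponent of the size of the subtree at `hangPos u t`. -/
def blockExp (L m u t : ℕ) : ℕ := hangExp L (if Even (L - t) then u / m else u % m) (L - t)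

theorem blockExp_inj {L m u u' t t' : ℕ} (ht : t ≤ L) (ht' : t' ≤ L)
    (h : blockExp L m u t = blockExp L m u' t') :
    t = t' ∧ (if Even (L - t) then u / m else u % m) =
      if Even (L - t) then u' / m else u' % m := by
  obtain ⟨h1, h2⟩ := hangExp_inj (by omega) (by omega) h
  have : t = t' := by omega
  subst this
  exact ⟨rfl, h1⟩

/-- The summand 1 in `v + 1` in `hangExp` serves this purpose: the hanging sizes occupy bits above
the number of spine edges, which is at most L + 1 < 2^(L+1). -/
theorem le_blockExp (L m u t : ℕ) : L + 1 ≤ blockExp L m u t := by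
  unfold blockExp hangExp
  generalize (if Even (L - t) then u / m else u % m) = v
  nlinarith [Nat.zero_le ((L + 1) * v), Nat.zero_le (L - t)]

/-- Each exponent encodes its level and one half of the block number. Level 2k yields `u / m` and
level 2k+1 yields `u % m`, which is why the chosen pairs are two edges apart. -/
theorem eq_of_blockExp_image_eq {L m u u' k : ℕ} (hL : Even L) (hk : 2 * k + 2 ≤ L)
    {I I' : Finset ℕ} (hI' : ∀ t ∈ I', t < L)
    (h : I.image (blockExp L m u) = I'.image (blockExp L m u')) (h0 : 2 * k ∈ I)
    (h1 : 2 * k + 1 ∈ I) : u = u' ∧ 2 * k ∈ I' := by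
  have key : ∀ t ∈ I, t ≤ L → t ∈ I' ∧ (if Even (L - t) then u / m else u % m) =
      if Even (L - t) then u' / m else u' % m := by
    intro t ht htL
    have h2 := Finset.mem_image_of_mem (blockExp L m u) ht
    rw [h] at h2
    obtain ⟨t', ht', he⟩ := Finset.mem_image.1 h2
    obtain ⟨h3, h4⟩ := blockExp_inj htL (hI' t' ht').le he.symm
    exact ⟨h3 ▸ ht', h4⟩
  obtain ⟨k0, e0⟩ := key _ h0 (by omega)
  obtain ⟨-, e1⟩ := key _ h1 (by omega)
  rw [if_pos (by rw [Nat.even_sub (by omega)]; simp [hL]),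
    if_pos (by rw [Nat.even_sub (by omega)]; simp [hL])] at e0
  rw [if_neg (by rw [Nat.even_sub (by omega)]; simp [hL]),
    if_neg (by rw [Nat.even_sub (by omega)]; simp [hL])] at e1
  refine ⟨?_, k0⟩
  rw [← Nat.div_add_mod u m, ← Nat.div_add_mod u' m, e0, e1]

/-- The Cartesian tree of the hard string. -/
def hardTree (L m : ℕ) : BinaryTree Unit :=
  zigzagChain (hangSize L m) (fun u => 2 ^ centerExp L m u) L (m * m)

theorem cartesianTree_hardString (L m : ℕ) :
    cartesianTree (hardString L m) = hardTree L m := by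
  rw [hardString, cartesianTree_chainString fun u y hy => pos_of_mem_blockString hy,
    cartesianTree_twinRuns (by omega)]
  simp only [blockString, cartesianTree_zigzagString _ _ le_rfl]
  rfl

/-! ### Cluster sizes and the lower bound for the hard tree -/

section Bound

variable {L m : ℕ}

theorem hangSize_pos (u r : ℕ) : 0 < hangSize L m u r := by unfold hangSize; positivity

theorem hangSize_le {u r : ℕ} (hu : u < m * m) (hr : r ≤ L) :
    hangSize L m u r ≤ 2 ^ ((L + 1) * (m + 1)) := by
  have hm : 0 < m := Nat.pos_of_ne_zero fun h => by simp [h] at hu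
  have hv : (if Even r then u / m else u % m) + 1 ≤ m := by
    split_ifs
    · exact Nat.div_lt_of_lt_mul hu
    · exact Nat.mod_lt _ hm
  refine Nat.pow_le_pow_right (by norm_num) ?_
  unfold hangExp
  generalize (if Even r then u / m else u % m) = v at hv
  have := Nat.mul_le_mul_left (L + 1) hv
  have h2 : (L + 1) * (m + 1) = (L + 1) * m + (L + 1) := by ring
  omega

theorem two_pow_centerExp_succ (u : ℕ) :
    2 ^ centerExp L m (u + 1) = 4 * 2 ^ centerExp L m u := by
  unfold centerExp
  ring

/-- The offset in `centerExp` is chosen so that one path at a lowest node outweighs the spine and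
all hanging paths of a block together. -/
theorem add_le_two_pow_centerExp (u : ℕ) :
    L + 2 + L * 2 ^ ((L + 1) * (m + 1)) ≤ 2 ^ centerExp L m u := by
  have h1 : L + 2 ≤ 2 ^ (L + 1) := Nat.lt_two_pow_self
  have h2 : 1 ≤ 2 ^ ((L + 1) * (m + 1)) := Nat.one_le_two_pow
  have h3 : 2 ^ ((L + 1) * (m + 1)) * 2 ^ (L + 1) * 2 ^ 2 ≤ 2 ^ centerExp L m u := by
    rw [← pow_add, ← pow_add]
    exact Nat.pow_le_pow_right (by norm_num) (by unfold centerExp; omega)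
  refine le_trans ?_ h3
  generalize 2 ^ ((L + 1) * (m + 1)) = b at *
  generalize 2 ^ (L + 1) = c at *
  have h4 : b * (L + 2) ≤ b * c := Nat.mul_le_mul_left b h1
  nlinarith [Nat.mul_le_mul_right L h2]

theorem numNodes_block_le {u : ℕ} (hu : u < m * m) :
    1 + (zigzag (hangSize L m u) (2 ^ centerExp L m u) L).numNodes ≤ 3 * 2 ^ centerExp L m u := by
  have h1 := numNodes_zigzag_le (f := hangSize L m u) (w := 2 ^ centerExp L m u)
    fun r (hr : r ≤ L) => hangSize_le hu hr
  have h2 := add_le_two_pow_centerExp (L := L) (m := m) u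
  omega

theorem two_pow_centerExp_mono {u v : ℕ} (h : u ≤ v) :
    2 ^ centerExp L m u ≤ 2 ^ centerExp L m v :=
  Nat.pow_le_pow_right (by norm_num) (by unfold centerExp; omega)

variable {F F' : Set TreePos} {u u' k k' : ℕ}

theorem ncard_lt_of_inner (hL : Even L) (hF : IsCluster (hardTree L m) F) (hu : u < m * m)
    {s : ℕ} (hs : s ≤ L) (hsF : spinePos u s ∈ F)
    (hq : ∀ v ≤ m * m, lowPos L (m * m) v true ∉ F) : F.ncard < 2 ^ centerExp L m 0 := by
  obtain ⟨a, ha, I, hI, hn⟩ := exists_ncard_eq hL (fun u => by positivity) hF hu hs hsF hq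
  have h1 : ∑ t ∈ I, hangSize L m u (L - t) ≤ L * 2 ^ ((L + 1) * (m + 1)) := by
    refine (Finset.sum_le_card_nsmul _ _ _ fun t _ => hangSize_le hu (Nat.sub_le _ _)).trans ?_
    rw [smul_eq_mul]
    refine Nat.mul_le_mul_right _ ?_
    have : I ⊆ Finset.range L := fun t ht => Finset.mem_range.2 ((hI t).1 ht).1
    simpa using Finset.card_le_card this
  have h2 := add_le_two_pow_centerExp (L := L) (m := m) 0
  omega

theorem exists_mem_of_inner (hL : Even L) (hF : IsCluster (hardTree L m) F)
    (hF' : IsCluster (hardTree L m) F') (hu : u < m * m) (hu' : u' < m * m)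
    (hk : 2 * k + 2 ≤ L) (hk' : 2 * k' + 2 ≤ L)
    (hx : spinePos u (2 * k) ∈ F) (hy : spinePos u (2 * k + 2) ∈ F)
    (hx' : spinePos u' (2 * k') ∈ F')
    (hq : ∀ v ≤ m * m, lowPos L (m * m) v true ∉ F)
    (hq' : ∀ v ≤ m * m, lowPos L (m * m) v true ∉ F') (hc : F.ncard = F'.ncard) :
    ∃ x, x ∈ F ∧ x ∈ F' := by
  have hw : ∀ u, 0 < 2 ^ centerExp L m u := fun u => by positivity
  obtain ⟨a, ha, I, hI, hn⟩ := exists_ncard_eq hL hw hF hu hk hy hq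
  obtain ⟨a', ha', I', hI', hn'⟩ := exists_ncard_eq hL hw hF' hu' (by omega) hx' hq'
  obtain ⟨g0, g1⟩ := hangPos_mem_of_spinePos_mem hL hangSize_pos hF hu hk hx hy
  have hsum : ∀ (u : ℕ) (I : Finset ℕ), (∀ t ∈ I, t < L) →
      ∑ t ∈ I, hangSize L m u (L - t) = ∑ i ∈ I.image (blockExp L m u), 2 ^ i := by
    intro u I hI
    rw [Finset.sum_image]
    · rfl
    · intro t ht t' ht' h
      exact (blockExp_inj (hI t ht).le (hI t' ht').le h).1
  have hlt : ∀ t ∈ I, t < L := fun t ht => ((hI t).1 ht).1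
  have hlt' : ∀ t ∈ I', t < L := fun t ht => ((hI' t).1 ht).1
  have hge : ∀ (u : ℕ) (I : Finset ℕ), ∀ i ∈ I.image (blockExp L m u), L + 1 ≤ i := by
    intro u I i hi
    obtain ⟨t, -, rfl⟩ := Finset.mem_image.1 hi
    exact le_blockExp L m u t
  have hpow : L + 1 < 2 ^ (L + 1) := Nat.lt_two_pow_self
  rw [hn, hn', hsum u I hlt, hsum u' I' hlt'] at hc
  have himg := eq_of_add_sum_two_pow_eq (by omega) (by omega) (hge u I) (hge u' I') hc
  obtain ⟨rfl, h0⟩ := eq_of_blockExp_image_eq hL hk hlt' himg ((hI _).2 ⟨by omega, g0⟩)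
    ((hI _).2 ⟨by omega, g1⟩)
  exact ⟨_, g0, ((hI' _).1 h0).2⟩

/-- If v < v', then |F| < w(v+1) ≤ w(v') ≤ |F'|. Applied in both directions, this makes the last
block with low edges a function of the size. -/
theorem eq_of_ncard_eq_of_max (hL : Even L) (hF : IsCluster (hardTree L m) F)
    (hF' : IsCluster (hardTree L m) F') (hu' : u' < m * m) {s' : ℕ} (hs' : s' < L)
    (hx' : spinePos u' s' ∈ F') {v v' : ℕ} (hv' : v' ≤ m * m)
    (hq : lowPos L (m * m) v true ∈ F)
    (hmax : ∀ v' ≤ m * m, v < v' → lowPos L (m * m) v' true ∉ F)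
    (hq' : lowPos L (m * m) v' true ∈ F') (hc : F.ncard = F'.ncard) : v' ≤ v := by
  by_contra! hlt
  have hw : ∀ u, 0 < 2 ^ centerExp L m u := fun u => by positivity
  have hw0 : 2 ≤ 2 ^ centerExp L m 0 := by
    have := add_le_two_pow_centerExp (L := L) (m := m) 0
    omega
  have h1 := ncard_lt_of_max hL hw hw0 two_pow_centerExp_succ
    (fun u hu => numNodes_block_le hu) hF (by omega) hq hmax
  have h2 := le_ncard_of_lowPos_mem hL hw hF' hu' hs' hx' hv' hq'
  have h3 := two_pow_centerExp_mono (L := L) (m := m) (show v + 1 ≤ v' from hlt)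
  omega

/-- Clusters with low edges have size at least w(0) and those without have smaller size, so equal
sizes put both in the same case. -/
theorem exists_mem_of_ncard_eq (hL : Even L) (hF : IsCluster (hardTree L m) F)
    (hF' : IsCluster (hardTree L m) F') (hu : u < m * m) (hu' : u' < m * m)
    (hk : 2 * k + 2 ≤ L) (hk' : 2 * k' + 2 ≤ L)
    (hx : spinePos u (2 * k) ∈ F) (hy : spinePos u (2 * k + 2) ∈ F)
    (hx' : spinePos u' (2 * k') ∈ F') (hc : F.ncard = F'.ncard) : ∃ x, x ∈ F ∧ x ∈ F' := by
  have hw : ∀ u, 0 < 2 ^ centerExp L m u := fun u => by positivity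
  by_cases h : ∃ v ≤ m * m, lowPos L (m * m) v true ∈ F <;>
    by_cases h' : ∃ v ≤ m * m, lowPos L (m * m) v true ∈ F'
  · obtain ⟨v, hv, hq, hmax⟩ := exists_max_le h
    obtain ⟨v', hv', hq', hmax'⟩ := exists_max_le h'
    have h1 := eq_of_ncard_eq_of_max hL hF hF' hu' (by omega) hx' hv' hq hmax hq' hc
    have h2 := eq_of_ncard_eq_of_max hL hF' hF hu (by omega) hx hv hq' hmax' hq hc.symm
    obtain rfl := le_antisymm h1 h2
    exact ⟨_, hq, hq'⟩
  · obtain ⟨v, hv, hq⟩ := h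
    push Not at h'
    have h1 := le_ncard_of_lowPos_mem hL hw hF hu (by omega) hx hv hq
    have h2 := ncard_lt_of_inner hL hF' hu' (by omega) hx' h'
    have h3 := two_pow_centerExp_mono (L := L) (m := m) v.zero_le
    omega
  · obtain ⟨v, hv, hq⟩ := h'
    push Not at h
    have h1 := le_ncard_of_lowPos_mem hL hw hF' hu' (by omega) hx' hv hq
    have h2 := ncard_lt_of_inner hL hF hu (by omega) hx h
    have h3 := two_pow_centerExp_mono (L := L) (m := m) v.zero_le
    omega
  · push Not at h h'
    exact exists_mem_of_inner hL hF hF' hu hu' hk hk' hx hy hx' h h' hc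

theorem le_dagSize_of_isTopTree (hL : Even L) {t : TopTree} (ht : IsTopTree (hardTree L m) t) :
    m * m * (L / 2) ≤ t.dagSize := by
  obtain ⟨𝓕, h𝓕⟩ := IsClusterTree.exists_family ht
  have hw : ∀ u, 0 < 2 ^ centerExp L m u := fun u => by positivity
  set I := Finset.range (m * m) ×ˢ Finset.range (L / 2) with hI
  have hmem : ∀ i ∈ I, i.1 < m * m ∧ 2 * i.2 + 2 ≤ L := by
    intro i hi
    simp only [hI, Finset.mem_product, Finset.mem_range] at hi
    omega
  have hex : ∀ i : ℕ × ℕ, ∃ F, i ∈ I → F ∈ 𝓕 ∧ spinePos i.1 (2 * i.2) ∈ F ∧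
      spinePos i.1 (2 * i.2 + 2) ∈ F ∧
      ∀ G ∈ 𝓕, spinePos i.1 (2 * i.2) ∈ G → spinePos i.1 (2 * i.2 + 2) ∈ G → F ⊆ G := by
    intro i
    by_cases hi : i ∈ I
    · obtain ⟨h1, h2⟩ := hmem i hi
      obtain ⟨F, hF⟩ := h𝓕.exists_least
        (spinePos_mem_treeEdges (f := hangSize L m) hL hw h1 (t := 2 * i.2) (by omega))
        (spinePos_mem_treeEdges (f := hangSize L m) hL hw h1 (t := 2 * i.2 + 2) (by omega))
      exact ⟨F, fun _ => hF⟩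
    · exact ⟨∅, fun h => absurd h hi⟩
  choose Φ hΦ using hex
  have hcard : I.card = m * m * (L / 2) := by simp [hI]
  rw [← hcard]
  refine h𝓕.card_le_dagSize I Φ (fun i hi => (hΦ i hi).1) ?_
  rintro i hi j hj hc
  obtain ⟨hi1, hi2⟩ := hmem i hi
  obtain ⟨hj1, hj2⟩ := hmem j hj
  obtain ⟨Fi, xi, yi, mi⟩ := hΦ i hi
  obtain ⟨Fj, xj, yj, mj⟩ := hΦ j hj
  obtain ⟨x, hxi, hxj⟩ := exists_mem_of_ncard_eq hL (h𝓕.isCluster _ Fi) (h𝓕.isCluster _ Fj)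
    hi1 hj1 hi2 hj2 xi yi xj hc
  have heq : Φ i = Φ j := h𝓕.eq_of_ncard_eq Fi Fj hc hxi hxj
  rw [← heq] at xj yj mj
  -- From here on a single cluster is least for both pairs. It is not a single edge, and neither
  -- child contains either pair, so both pairs are separated by the merge.
  rcases h𝓕.merge _ Fi with hsub | ⟨A, hA, B, hB, hAB, hd⟩
  · have h1 := congrArg List.length (hsub xi yi)
    rw [length_spinePos, length_spinePos] at h1
    omega
  · have cA := h𝓕.isCluster A hA
    have cB := h𝓕.isCluster B hB
    have nA : ¬ Φ i ⊆ A := fun h => by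
      obtain ⟨b, hb⟩ := cB.nonempty
      exact Set.disjoint_left.1 hd (h (hAB ▸ Or.inr hb)) hb
    have nB : ¬ Φ i ⊆ B := fun h => by
      obtain ⟨b, hb⟩ := cA.nonempty
      exact Set.disjoint_left.1 hd hb (h (hAB ▸ Or.inl hb))
    obtain ⟨h1, h2⟩ := eq_of_separated cA cB hd (hAB ▸ xi) (hAB ▸ yi) (hAB ▸ xj) (hAB ▸ yj)
      (fun h => nA (mi A hA h.1 h.2)) (fun h => nB (mi B hB h.1 h.2))
      (fun h => nA (mj A hA h.1 h.2)) (fun h => nB (mj B hB h.1 h.2))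
    exact Prod.ext h1 h2

theorem treeEdges_hardTree_nonempty (hL : Even L) : (treeEdges (hardTree L m)).Nonempty :=
  ⟨_, lowPos_mem_treeEdges hL (fun u => by positivity) le_rfl true⟩

end Bound

/-! ### Choice of the parameters -/

theorem theorem4 :
    ∀ C : ℝ, 0 < C → ∃ c : ℝ, 0 < c ∧ ∃ σ₀ : ℕ, ∀ σ s : ℕ, σ₀ ≤ σ → C * (σ : ℝ) ^ 2 ≤ (s : ℝ) →
      ∃ S : List ℕ, (∀ a ∈ S, a < σ) ∧
        (∃ G : SLP ℕ, G.Generates S ∧ G.size = s) ∧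
        (∃ t : TopTree, IsTopTree (cartesianTree S) t) ∧
        ∀ t : TopTree, IsTopTree (cartesianTree S) t →
          c * (s : ℝ) * (σ : ℝ) ≤ (t.dagSize : ℝ) := by
  intro C hC
  -- `D` is the ratio of √s to m. The part 400/C gives 20mσ ≤ s and the part 6 gives 32m² ≤ s; `E`
  -- gives 12σ ≤ s. Each of the three controls about a quarter of the SLP budget.
  obtain ⟨D, hD⟩ := exists_nat_ge (400 / C + 6)
  obtain ⟨E, hE⟩ := exists_nat_ge (12 / C)
  have hD6 : (6 : ℝ) ≤ D := by
    have : 0 < 400 / C := by positivity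
    linarith
  have hDC : 400 ≤ (D : ℝ) ^ 2 * C := by
    have h1 : 400 / C ≤ D := by linarith
    rw [div_le_iff₀ hC] at h1
    nlinarith [mul_pos (show (0 : ℝ) < D by linarith) hC]
  have hD6' : 6 ≤ D := by exact_mod_cast hD6
  -- The constant combines s ≤ 4D²m² with σ ≤ 4K. In the threshold, D² ensures m ≥ 1 and 8 ensures σ
  -- ≤ 4K.
  refine ⟨1 / (16 * (D : ℝ) ^ 2), by positivity, E + D ^ 2 + 8, fun σ s hσ hs => ?_⟩
  have hσs : 12 * σ ≤ s := by
    have h1 : 12 / C ≤ σ := hE.trans (by exact_mod_cast (by omega : E ≤ σ))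
    rw [div_le_iff₀ hC] at h1
    have h2 : (12 : ℝ) * σ ≤ s := by nlinarith [(Nat.cast_nonneg σ : (0 : ℝ) ≤ σ)]
    exact_mod_cast h2
  set m := Nat.sqrt s / D with hm
  -- The zigzag length is L = 2K, the largest even number with L + 3 ≤ σ, as the letters used are at
  -- most L + 2.
  set K := (σ - 3) / 2 with hK
  have hmD : m * D ≤ Nat.sqrt s := Nat.div_mul_le_self _ _
  have hmDs : (m * D) ^ 2 ≤ s := (Nat.pow_le_pow_left hmD 2).trans (Nat.sqrt_le' s)
  have hm1 : 1 ≤ m := by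
    rw [hm, Nat.le_div_iff_mul_le (by omega), one_mul, Nat.le_sqrt']
    omega
  have hsm : s ≤ 4 * D ^ 2 * (m * m) := by
    have h1 : Nat.sqrt s + 1 ≤ D * (m + 1) := Nat.lt_mul_div_succ _ (by omega)
    have h2 : s < (Nat.sqrt s + 1) ^ 2 := Nat.lt_succ_sqrt' s
    calc s ≤ (D * (m + 1)) ^ 2 := h2.le.trans (Nat.pow_le_pow_left h1 2)
      _ ≤ (D * (2 * m)) ^ 2 := Nat.pow_le_pow_left (Nat.mul_le_mul_left _ (by omega)) 2
      _ = 4 * D ^ 2 * (m * m) := by ring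
  have hmσ : 20 * (m * σ) ≤ s := by
    have h1 : ((m : ℝ) * D) ^ 2 ≤ s := by exact_mod_cast hmDs
    -- The hypothesis s ≥ Cσ² supplies one factor s, and (mD)² ≤ s the other.
    have h2 : (20 * ((m : ℝ) * σ)) ^ 2 ≤ (s : ℝ) ^ 2 := by
      calc (20 * ((m : ℝ) * σ)) ^ 2 = 400 * (m * σ) ^ 2 := by ring
        _ ≤ ((D : ℝ) ^ 2 * C) * (m * σ) ^ 2 := mul_le_mul_of_nonneg_right hDC (sq_nonneg _)
        _ = ((m : ℝ) * D) ^ 2 * (C * (σ : ℝ) ^ 2) := by ring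
        _ ≤ s * s := mul_le_mul h1 hs (by positivity) (by positivity)
        _ = (s : ℝ) ^ 2 := by ring
    have h3 := le_of_sq_le_sq h2 (Nat.cast_nonneg s)
    exact_mod_cast h3
  have hmm : 32 * (m * m) ≤ s := by
    have : 36 * (m * m) ≤ (m * D) ^ 2 := by nlinarith [Nat.mul_le_mul hD6' hD6']
    omega
  have hL : Even (2 * K) := even_two_mul K
  have hT := cartesianTree_hardString (2 * K) m
  refine ⟨hardString (2 * K) m, fun a ha => ?_, ?_, ?_, ?_⟩
  · have := lt_of_mem_hardString a ha
    omega
  · refine exists_slp_hardString ?_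
    have h1 : 5 * (m * (2 * K)) + 5 * m ≤ 5 * (m * σ) := by
      have := Nat.mul_le_mul_left m (show 2 * K + 1 ≤ σ by omega)
      nlinarith
    omega
  · rw [hT]
    exact exists_isTopTree (treeEdges_hardTree_nonempty hL)
  · intro t ht
    rw [hT] at ht
    have h1 := le_dagSize_of_isTopTree hL ht
    rw [Nat.mul_div_cancel_left K (by norm_num)] at h1
    have h2 : s * σ ≤ 16 * D ^ 2 * t.dagSize := by
      calc s * σ ≤ (4 * D ^ 2 * (m * m)) * (4 * K) := Nat.mul_le_mul hsm (by omega)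
        _ = 16 * D ^ 2 * (m * m * K) := by ring
        _ ≤ 16 * D ^ 2 * t.dagSize := Nat.mul_le_mul_left _ h1
    have h3 : (s : ℝ) * σ ≤ 16 * (D : ℝ) ^ 2 * t.dagSize := by exact_mod_cast h2
    rw [mul_assoc, div_mul_eq_mul_div, one_mul, div_le_iff₀ (by positivity)]
    linarith
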